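/- Let $k$ be a field of arbitrary characteristic, let $\widetilde{\mathcal O}=k[[t_1]]\times\cdots\times k[[t_d]]$, and let $\mathcal O\subseteq\widetilde{\mathcal O}$ be a local $k$-subalgebra of finite $k$-codimension (a totally rational complete curve-singularity ring with $d$ branches, identified with its image in its normalization). For $n\in\mathbb N^d$ put $\|n\|=n_1+\cdots+n_d$, $t^n=(t_1^{n_1},\dots,t_d^{n_d})$, $T^n=T_1^{n_1}\cdots T_d^{n_d}$. Let $S\subseteq\mathbb N^d$ be the semigroup of values $(\operatorname{ord} z_1,\dots,\operatorname{ord} z_d)$ of the non-zero-divisors $z\in\mathcal O$, and let $c$ be its conductor, the minimal element of $\mathbb N^d$ (for the product order) with $c+\mathbb N^d\subseteq S$. Let $\mathcal M_k=K_0(\mathrm{Var}_k)[\mathbb L^{-1}]$, where $K_0(\mathrm{Var}_k)$ is the Grothendieck ring of varieties and $\mathbb L=[\mathbb A^1_k]$. Let $\mathcal J=\widetilde{\mathcal O}^\times/\mathcal O^\times$, considered as a $k$-variety of polynomial representatives $\mu$ of the classes, and for $n\in S$ let $\mathcal I_n\subseteq\mathcal J$ be the closed subvariety defined by the condition $t^n\mu\in\mathcal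 O$; its points parametrize the principal ideals $z\mathcal O=t^n\mu\mathcal O$ whose generator has value $n$. Put $$Z(T_1,\dots,T_d,\mathcal O)=\sum_{n\in S}[\mathcal I_n]\,\mathbb L^{-\|n\|}T^n\in\mathcal M_k[[T_1,\dots,T_d]].$$ Let $I_0=\{1,\dots,d\}$. For $\emptyset\ne J\subsetneq I_0$ and $m\in\mathbb N^{I_0\setminus J}$ with $m_i<c_i$ for all $i\in I_0\setminus J$, put $H_{J,m}=\{n\in S: n_j\ge c_j \text{ for } j\in J,\ n_j=m_j\text{ for } j\notin J\}$; let $B_J$ be the (finite) set of those $m$ for which $H_{J,m}\neq\emptyset$, and let $f_J(m)\in\mathbb N^d$ have the entries $c_j$ for $j\in J$ and $m_j$ for $j\notin J$. (1) For all such $J$ and all $m\in B_J$ one has $f_J(m)\in S$, and $$Z(T_1,\dots,T_d,\mathcal O)=\sum_{\substack{n\in S\\ n_i<c_i\ \forall i}}[\mathcal I_n]\mathbb L^{-\|n\|}T^n+\sum_{\emptyset\subsetneq J\subsetneq I_0}\ \sum_{m\in B_J}[\mathcal I_{f_J(m)}]\,\mathbb L^{-\|f_J(m)\|}\frac{T^{f_J(m)}}{\prod_{j\in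 J}(1-\mathbb L^{-1}T_j)}+[\mathcal J]\,\mathbb L^{-\|c\|}\frac{T^c}{\prod_{i=1}^d(1-\mathbb L^{-1}T_i)}.$$ (2) $$Z(T_1,\dots,T_d,\mathcal O)=\frac{M(T_1,\dots,T_d,\mathcal O)}{\prod_{i=1}^d(1-\mathbb L^{-1}T_i)},$$ where $M$ is a polynomial in $\mathcal M_k[T_1,\dots,T_d]$ of total degree at most $\|c\|$ with $M(\mathbb L,\dots,\mathbb L,\mathcal O)=[\mathcal J]$. -/

import Mathlib

open CategoryTheory AlgebraicGeometry

namespace MotivicZeta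

universe u

/-! ### The Grothendieck ring of varieties -/

section GrothendieckRing

variable (k : Type u) [Field k]

/-- A variety over `k`: a separated scheme of finite type over `Spec k`. -/
structure Variety where
  /-- the underlying scheme over `Spec k` -/
  toOver : Over (Spec (CommRingCat.of k))
  locallyOfFiniteType : LocallyOfFiniteType toOver.hom
  quasiCompact : QuasiCompact toOver.hom
  isSeparated : IsSeparated toOver.hom

/-- The affine variety `Spec A` of a finitely generated `k`-algebra `A`. -/
noncomputable def affineVariety (A : Type u) [CommRing A] [Algebra k A] [Algebra.FiniteType k A] :
    Variety k where
  toOver := Over.mk (Spec.map (CommRingCat.ofHom (algebraMap k A)))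
  locallyOfFiniteType := by
    have h : (algebraMap k A).FiniteType :=
      (RingHom.finiteType_algebraMap).2 inferInstance
    exact (HasRingHomProperty.Spec_iff (P := @LocallyOfFiniteType)).2 h
  quasiCompact := by dsimp; infer_instance
  isSeparated := by dsimp; infer_instance

/-- The relations of the Grothendieck ring of varieties: isomorphic varieties have the same
class, the scissor relations, products, and the point has class `1`. -/
inductive K0Rel : FreeCommRing (Variety k) → Prop
  | iso (V W : Variety k) (e : V.toOver ≅ W.toOver) :
      K0Rel (FreeCommRing.of V - FreeCommRing.of W)
  | scissor (V U Z : Variety k) (j : U.toOver ⟶ V.toOver) (i : Z.toOver ⟶ V.toOver)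
      (hj : IsOpenImmersion j.left) (hi : IsClosedImmersion i.left)
      (hc : Set.range j.left = (Set.range i.left)ᶜ) :
      K0Rel (FreeCommRing.of V - (FreeCommRing.of U + FreeCommRing.of Z))
  | prod (P V W : Variety k) (p : P.toOver ⟶ V.toOver) (q : P.toOver ⟶ W.toOver)
      (h : IsPullback p.left q.left V.toOver.hom W.toOver.hom) :
      K0Rel (FreeCommRing.of P - FreeCommRing.of V * FreeCommRing.of W)
  | point : K0Rel (FreeCommRing.of (affineVariety k k) - 1)

/-- The Grothendieck ring `K₀(Var_k)` of varieties over `k`. -/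
abbrev K0Var : Type (u + 1) :=
  FreeCommRing (Variety k) ⧸ Ideal.span {x | K0Rel k x}

/-- The class of the affine line in `K₀(Var_k)`. -/
noncomputable def lefschetz : K0Var k :=
  Ideal.Quotient.mk _ (FreeCommRing.of (affineVariety k (Polynomial k)))

/-- The ring `ℳ_k = K₀(Var_k)[𝕃⁻¹]`. -/
abbrev MotivicRing : Type (u + 1) := Localization.Away (lefschetz k)

/-- The class `[V]` of a variety in `ℳ_k`. -/
noncomputable def motivicClass (V : Variety k) : MotivicRing k :=
  algebraMap (K0Var k) (MotivicRing k) (Ideal.Quotient.mk _ (FreeCommRing.of V))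

/-- `𝕃` as an element of `ℳ_k`. -/
noncomputable def motL : MotivicRing k := algebraMap (K0Var k) (MotivicRing k) (lefschetz k)

/-- `𝕃⁻¹` as an element of `ℳ_k`. -/
noncomputable def motLinv : MotivicRing k :=
  IsLocalization.Away.invSelf (S := MotivicRing k) (lefschetz k)

theorem motL_mul_motLinv : motL k * motLinv k = 1 :=
  IsLocalization.Away.mul_invSelf (S := MotivicRing k) (lefschetz k)

end GrothendieckRing

/-! ### Totally rational curve singularity rings -/

section Ring

variable {k : Type u} [Field k] {d : ℕ}

/-- A totally rational complete curve singularity ring with `d` branches, identified with its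
image in its normalization `k⟦t₁⟧ × ⋯ × k⟦t_d⟧`: a local `k`-subalgebra of finite
`k`-codimension. -/
structure IsCurveSingularityRing (O : Subalgebra k (Fin d → PowerSeries k)) : Prop where
  isLocalRing : IsLocalRing O
  finite_codim : Module.Finite k ((Fin d → PowerSeries k) ⧸ Subalgebra.toSubmodule O)

/-- The semigroup of values `S`. -/
def semigroup (O : Subalgebra k (Fin d → PowerSeries k)) : Set (Fin d → ℕ) :=
  {n | ∃ z ∈ O, ∀ i, (z i).order = n i}

/-- `c` is the conductor of `S`: it is minimal for the product order with `c + ℕ^d ⊆ S`. -/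
def IsConductor (O : Subalgebra k (Fin d → PowerSeries k)) (c : Fin d → ℕ) : Prop :=
  Minimal (fun c' : Fin d → ℕ => ∀ n, c' + n ∈ semigroup O) c

/-- For `a = (a_{i,j})` with finitely many nonzero entries, the linear form
`z ↦ ∑ a_{i,j} z_{i,j}` on `∏ R⟦t_i⟧`, where `z_{i,j}` is the coefficient of `t_i ^ j` in the
`i`-th component of `z`. -/
noncomputable def linForm {R : Type*} [CommRing R] [Algebra k R] (a : (Fin d × ℕ) →₀ k)
    (z : Fin d → PowerSeries R) : R :=
  a.sum fun p b => b • PowerSeries.coeff p.2 (z p.1)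

/-- `a` is one of the linear equations (in finitely many coefficients) that hold on `O`. Together
they form the system `Δ = 0` that defines `O`. -/
def IsEquation (O : Subalgebra k (Fin d → PowerSeries k)) (a : (Fin d × ℕ) →₀ k) : Prop :=
  ∀ y ∈ O, linForm a y = 0

/-- The `R`-points of `O` for a `k`-algebra `R`: the solutions of `Δ = 0` in `∏ R⟦t_i⟧`. -/
def points (O : Subalgebra k (Fin d → PowerSeries k)) (R : Type*) [CommRing R] [Algebra k R] :
    Set (Fin d → PowerSeries R) :=
  {z | ∀ a, IsEquation O a → linForm a z = 0}

/-! ### The variety `𝒥 = Õˣ / Oˣ` and the subvarieties `ℐ_n`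

Order the coefficients of `z ∈ ∏ k⟦t_i⟧` as `a_{1,0}, …, a_{d,0}, a_{1,1}, …, a_{d,1}, …`. A place
is leading if some element of `O` has its first nonzero coefficient there; the other places are
finitely many (as many as the singularity degree). Every class of `Õˣ / Oˣ` has exactly one
representative whose coefficients at the leading places are `1` at the first place and `0` at the
other ones, and the remaining coefficients, those at the gaps, are free, except that the constant
terms are nonzero. This holds over every `k`-algebra, see `existsUnique_representative`. These
polynomial representatives are the points of the affine variety `𝒥`. -/

/-- The position of the coefficient of `t_i ^ j` in the order above. -/
def position (p : Fin d × ℕ) : ℕ := p.2 * d + p.1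

/-- Some element of `O` has its first nonzero coefficient at `p`. -/
def IsLeading (O : Subalgebra k (Fin d → PowerSeries k)) (p : Fin d × ℕ) : Prop :=
  ∃ y ∈ O, PowerSeries.coeff p.2 (y p.1) ≠ 0 ∧
    ∀ q : Fin d × ℕ, position q < position p → PowerSeries.coeff q.2 (y q.1) = 0

/-- The gaps: the places that are not leading. -/
abbrev Gap (O : Subalgebra k (Fin d → PowerSeries k)) : Type := {p : Fin d × ℕ // ¬ IsLeading O p}

open Classical in
/-- The coefficients of the universal polynomial representative: a free variable at each gap,
`1` at the first place, and `0` at each other leading place. -/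
noncomputable def repCoeff (O : Subalgebra k (Fin d → PowerSeries k)) (p : Fin d × ℕ) :
    MvPolynomial (Gap O) k :=
  if h : IsLeading O p then (if position p = 0 then 1 else 0) else MvPolynomial.X ⟨p, h⟩

/-- The coordinate ring of `𝒥`: polynomials in the coefficients at the gaps, with the constant
terms of the representative inverted. -/
abbrev JRing (O : Subalgebra k (Fin d → PowerSeries k)) : Type u :=
  Localization.Away (∏ i : Fin d, repCoeff O (i, 0))

/-- The universal polynomial representative `μ`. -/
noncomputable def univRep (O : Subalgebra k (Fin d → PowerSeries k)) :
    Fin d → PowerSeries (JRing O) :=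
  fun i => PowerSeries.mk fun j => algebraMap _ (JRing O) (repCoeff O (i, j))

/-- The coordinate ring of `ℐ_n`, the closed subscheme of `𝒥` that is defined by the condition
`t^n μ ∈ O`: the class of `μ` corresponds to the principal ideal `t^n μ O`, see
`exists_points_equiv`. -/
abbrev IRing (O : Subalgebra k (Fin d → PowerSeries k)) (n : Fin d → ℕ) : Type u :=
  JRing O ⧸ Ideal.span {r : JRing O | ∃ a, IsEquation O a ∧
    r = linForm a (fun i => PowerSeries.X ^ n i * univRep O i)}

section Representatives

theorem linForm_sub {R : Type*} [CommRing R] [Algebra k R] (b c : (Fin d × ℕ) →₀ k)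
    (z : Fin d → PowerSeries R) : linForm (b - c) z = linForm b z - linForm c z :=
  Finsupp.sum_sub_index fun _ _ _ => sub_smul _ _ _

theorem linForm_smul {R : Type*} [CommRing R] [Algebra k R] (s : k) (c : (Fin d × ℕ) →₀ k)
    (z : Fin d → PowerSeries R) : linForm (s • c) z = s • linForm c z := by
  simp only [linForm]
  rw [Finsupp.sum_smul_index' (by simp), Finsupp.smul_sum]
  simp only [smul_assoc]

theorem linForm_single {R : Type*} [CommRing R] [Algebra k R] (p : Fin d × ℕ)
    (z : Fin d → PowerSeries R) :
    linForm (Finsupp.single p (1 : k)) z = PowerSeries.coeff p.2 (z p.1) := by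
  simp only [linForm]
  rw [Finsupp.sum_single_index (by simp), one_smul]

theorem position_injective : Function.Injective (position (d := d)) := by
  rintro ⟨i, j⟩ ⟨i', j'⟩ h
  have hd : 0 < d := i.pos
  simp only [position] at h
  have h1 : j = j' := by
    have := congrArg (· / d) h
    simpa [Nat.mul_add_div, Nat.add_div_of_dvd_right, Nat.add_comm, Nat.add_mul_div_right _ _ hd,
      Nat.div_eq_of_lt i.2, Nat.div_eq_of_lt i'.2] using this
  subst h1
  have h2 : (i : ℕ) = i' := by omega
  rw [Fin.ext h2]

theorem finite_position_lt (N : ℕ) : Finite {p : Fin d × ℕ // position p < N} :=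
  Finite.of_injective (fun p : {p : Fin d × ℕ // position p < N} => (⟨position p.1, p.2⟩ : Fin N))
    fun p q h => Subtype.ext (position_injective (by simpa using h))

/-- There are finitely many gaps. -/
theorem finite_gap {O : Subalgebra k (Fin d → PowerSeries k)} (hO : IsCurveSingularityRing O) :
    Finite (Gap O) := by
  classical
  have := hO.finite_codim
  let e : Gap O → (Fin d → PowerSeries k) ⧸ Subalgebra.toSubmodule O := fun p =>
    Submodule.Quotient.mk (Pi.single p.1.1 (PowerSeries.monomial p.1.2 (1 : k)))
  suffices LinearIndependent k e from this.finite
  rw [linearIndependent_iff]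
  intro l hl
  by_contra hne
  set y : Fin d → PowerSeries k :=
    l.sum fun p b => b • Pi.single p.1.1 (PowerSeries.monomial p.1.2 (1 : k)) with hy
  have hyO : y ∈ O := by
    have : (Submodule.Quotient.mk y : (Fin d → PowerSeries k) ⧸ Subalgebra.toSubmodule O) = 0 := by
      rw [← hl, hy, Finsupp.linearCombination_apply, Finsupp.sum, Finsupp.sum]
      rw [← Submodule.mkQ_apply, map_sum]
      rfl
    simpa using (Submodule.Quotient.mk_eq_zero _).1 this
  have hcoef : ∀ q : Fin d × ℕ, PowerSeries.coeff q.2 (y q.1) =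
      if h : IsLeading O q then 0 else l ⟨q, h⟩ := by
    intro q
    have h1 : PowerSeries.coeff q.2 (y q.1) = l.sum fun p b => if p.1 = q then b else 0 := by
      rw [hy, Finsupp.sum, Finsupp.sum, Finset.sum_apply, map_sum]
      refine Finset.sum_congr rfl fun p _ => ?_
      rcases p with ⟨⟨i, j⟩, hp⟩
      rcases q with ⟨i', j'⟩
      by_cases hi : i = i'
      · subst hi
        by_cases hj : j = j'
        · subst hj
          simp
        · simp [PowerSeries.coeff_monomial, hj, Ne.symm hj]
      · simp [hi]
    rw [h1]
    split_ifs with h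
    · refine Finset.sum_eq_zero fun p _ => if_neg fun hp : p.1 = q => p.2 (hp ▸ h)
    · rw [Finsupp.sum, Finset.sum_eq_single (⟨q, h⟩ : Gap O)]
      · simp
      · intro p _ hp
        exact if_neg fun hq => hp (Subtype.ext hq)
      · intro hq
        simpa using hq
  have hsupp : l.support.Nonempty := Finsupp.support_nonempty_iff.2 hne
  obtain ⟨p, hp, hmin⟩ := l.support.exists_min_image (fun p => position p.1) hsupp
  apply p.2
  refine ⟨y, hyO, ?_, ?_⟩
  · rw [hcoef, dif_neg p.2]
    simpa using hp
  · intro q hq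
    rw [hcoef]
    split_ifs with h
    · rfl
    · by_contra hlq
      exact absurd (hmin ⟨q, h⟩ (by simpa using hlq)) (by simpa using hq)

theorem finiteType_JRing {O : Subalgebra k (Fin d → PowerSeries k)}
    (hO : IsCurveSingularityRing O) : Algebra.FiniteType k (JRing O) := by
  have := finite_gap hO
  infer_instance

theorem finiteType_IRing {O : Subalgebra k (Fin d → PowerSeries k)}
    (hO : IsCurveSingularityRing O) (n : Fin d → ℕ) : Algebra.FiniteType k (IRing O n) := by
  have := finiteType_JRing hO
  exact Algebra.FiniteType.of_surjective (Ideal.Quotient.mkₐ k _) Ideal.Quotient.mk_surjective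

theorem coeff_zero_eq {O : Subalgebra k (Fin d → PowerSeries k)} (hO : IsCurveSingularityRing O)
    {y : Fin d → PowerSeries k} (hy : y ∈ O) (i i' : Fin d)
    (h : PowerSeries.coeff 0 (y i) = 0) : PowerSeries.coeff 0 (y i') = 0 := by
  have := hO.isLocalRing
  by_contra ha
  set a := PowerSeries.coeff 0 (y i') with ha'
  have key : ∀ (x : O) (l : Fin d), PowerSeries.coeff 0 (x.1 l) = 0 → ¬ IsUnit x := by
    intro x l hx hu
    have h1 : IsUnit (PowerSeries.constantCoeff (x.1 l)) := by
      have h2 := hu.map (((PowerSeries.constantCoeff (R := k)).comp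
        (Pi.evalRingHom (fun _ : Fin d => PowerSeries k) l)).comp O.val.toRingHom)
      exact h2
    rw [← PowerSeries.coeff_zero_eq_constantCoeff_apply, hx] at h1
    simp at h1
  have h1 : ¬ IsUnit (⟨y, hy⟩ : O) := key _ i h
  have h2 : ¬ IsUnit (algebraMap k O a - ⟨y, hy⟩) := by
    refine key _ i' ?_
    have : (algebraMap k O a - ⟨y, hy⟩ : O).1 i' = PowerSeries.C a - y i' := rfl
    rw [this, map_sub, PowerSeries.coeff_zero_C, ← ha', sub_self]
  have h3 : ¬ IsUnit ((⟨y, hy⟩ : O) + (algebraMap k O a - ⟨y, hy⟩)) :=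
    IsLocalRing.nonunits_add h1 h2
  rw [add_sub_cancel] at h3
  exact h3 ((IsUnit.mk0 a ha).map (algebraMap k O))

theorem isLeading_of_position_eq_zero (O : Subalgebra k (Fin d → PowerSeries k))
    {p : Fin d × ℕ} (hp : position p = 0) : IsLeading O p := by
  refine ⟨1, O.one_mem, ?_, fun q hq => absurd hq (by omega)⟩
  have hd : 0 < d := p.1.pos
  have : p.2 = 0 := by
    simp only [position, Nat.add_eq_zero_iff, Nat.mul_eq_zero] at hp
    omega
  simp [this]

/-- The coefficient at a gap is determined, on `O`, by earlier coefficients. -/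
theorem exists_equation {O : Subalgebra k (Fin d → PowerSeries k)} {p : Fin d × ℕ}
    (hp : ¬ IsLeading O p) : ∃ a : (Fin d × ℕ) →₀ k,
      (∀ q, a q ≠ 0 → position q < position p) ∧
      IsEquation O (Finsupp.single p 1 - a) := by
  classical
  have := finite_position_lt (d := d) (position p)
  let f : Fin d × ℕ → Subalgebra.toSubmodule O →ₗ[k] k := fun q =>
    ((PowerSeries.coeff q.2).comp (LinearMap.proj q.1)).comp (Subalgebra.toSubmodule O).subtype
  have h := mem_span_of_iInf_ker_le_ker
    (L := fun q : {q : Fin d × ℕ // position q < position p} => f q.1) (K := f p) (by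
      rintro ⟨y, hy⟩ hy0
      by_contra hne
      refine hp ⟨y, hy, hne, fun q hq => ?_⟩
      exact (Submodule.mem_iInf _).1 hy0 ⟨q, hq⟩)
  obtain ⟨b, hb⟩ := (Finsupp.mem_span_range_iff_exists_finsupp).1 h
  refine ⟨b.mapDomain Subtype.val, ?_, ?_⟩
  · intro q hq
    by_contra hlt
    refine hq (Finsupp.mapDomain_of_notMem_range _ _ ?_)
    rintro ⟨⟨q', hq'⟩, rfl⟩
    exact hlt hq'
  · intro y hy
    have h1 := LinearMap.congr_fun hb ⟨y, hy⟩
    rw [linForm_sub, sub_eq_zero, linForm_single]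
    simp only [linForm]
    rw [Finsupp.sum_mapDomain_index (by simp) (fun _ _ _ => add_smul _ _ _)]
    change PowerSeries.coeff p.2 (y p.1) = _
    have h3 : f p ⟨y, hy⟩ = PowerSeries.coeff p.2 (y p.1) := rfl
    rw [← h3, ← h1, Finsupp.sum, LinearMap.sum_apply]
    rfl

/-- Finitely many equations suffice: those at the gaps. -/
theorem mem_points_of_gap {O : Subalgebra k (Fin d → PowerSeries k)} {R : Type*} [CommRing R]
    [Algebra k R] (a : Gap O → (Fin d × ℕ) →₀ k)
    (ha : ∀ p q, a p q ≠ 0 → position q < position p.1)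
    (hae : ∀ p, IsEquation O (Finsupp.single p.1 1 - a p))
    (z : Fin d → PowerSeries R)
    (hz : ∀ p, linForm (Finsupp.single p.1 1 - a p) z = 0) : z ∈ points O R := by
  classical
  suffices ∀ N (b : (Fin d × ℕ) →₀ k), (∀ q, b q ≠ 0 → position q < N) → IsEquation O b →
      linForm b z = 0 by
    intro b hb
    refine this (b.support.sup position + 1) b (fun q hq => ?_) hb
    exact Nat.lt_succ_of_le (Finset.le_sup (f := position) (by simpa using hq))
  intro N
  induction N with
  | zero =>
    intro b hb _
    have : b = 0 := Finsupp.ext fun q => by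
      by_contra h
      exact absurd (hb q h) (by omega)
    simp [this, linForm]
  | succ N ih =>
    intro b hb hbe
    by_cases hN : ∃ p, position p = N ∧ b p ≠ 0
    · obtain ⟨p, hpN, hbp⟩ := hN
      by_cases hp : IsLeading O p
      · obtain ⟨y, hy, hy1, hy2⟩ := hp
        have h1 := hbe y hy
        rw [linForm, Finsupp.sum, Finset.sum_eq_single p] at h1
        · rw [smul_eq_mul, mul_eq_zero] at h1
          exact absurd h1 (by simp [hbp, hy1])
        · intro q hq hqp
          have h2 := hb q (by simpa using hq)
          have h3 : position q ≠ position p := fun h => hqp (position_injective h)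
          rw [hy2 q (by omega), smul_zero]
        · intro h
          exact absurd hbp (by simpa using h)
      · have h1 := ih (b - b p • (Finsupp.single p 1 - a ⟨p, hp⟩)) (by
          intro q hq
          by_contra hlt
          apply hq
          have haq : a ⟨p, hp⟩ q = 0 := by
            by_contra h
            have : position q < position p := ha _ _ h
            omega
          by_cases hqp : q = p
          · subst hqp
            simp [haq]
          · have : b q = 0 := by
              by_contra h
              have := hb q h
              exact hqp (position_injective (by omega))
            simp [haq, this, Finsupp.single_eq_of_ne hqp]) (by
          intro y hy
          rw [linForm_sub, linForm_smul, hbe y hy, hae ⟨p, hp⟩ y hy]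
          simp)
        rw [linForm_sub, linForm_smul, hz ⟨p, hp⟩] at h1
        simpa using h1
    · push Not at hN
      refine ih b (fun q hq => ?_) hbe
      have := hb q hq
      have : position q ≠ N := fun h => hq (hN q h)
      omega

/-- A system of equations that determines each coefficient by the earlier ones. -/
noncomputable def solve {R : Type*} [Zero R] (F : Fin d × ℕ → (Fin d × ℕ → R) → R)
    (p : Fin d × ℕ) : R :=
  F p fun q => if _ : position q < position p then solve F q else 0
termination_by position p

theorem existsUnique_solve {R : Type*} [Zero R] (F : Fin d × ℕ → (Fin d × ℕ → R) → R)
    (hF : ∀ p x y, (∀ q, position q < position p → x q = y q) → F p x = F p y) :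
    ∃! x, ∀ p, x p = F p x := by
  refine ⟨solve F, fun p => ?_, fun y hy => ?_⟩
  · rw [solve]
    exact hF p _ _ fun q hq => by simp [hq]
  · have : ∀ N p, position p = N → y p = solve F p := by
      intro N
      induction N using Nat.strong_induction_on with
      | _ N ih =>
        intro p hp
        rw [hy p, solve]
        refine hF p _ _ fun q hq => ?_
        rw [dif_pos hq]
        exact ih _ (hp ▸ hq) q rfl
    exact funext fun p => this _ p rfl

open Classical in
/-- Normal form: a unit of `∏ R⟦t_i⟧` has, up to multiplication by elements of `O(R)`, a unique
representative with the prescribed coefficients at the leading places. -/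
theorem existsUnique_mul {O : Subalgebra k (Fin d → PowerSeries k)} {R : Type*} [CommRing R]
    [Algebra k R] (u : Fin d → PowerSeries R) (hu : IsUnit u) :
    ∃! w : Fin d → PowerSeries R, w ∈ points O R ∧ ∀ p : Fin d × ℕ, IsLeading O p →
      PowerSeries.coeff p.2 ((u * w) p.1) = if position p = 0 then 1 else 0 := by
  choose a ha hae using fun p : Gap O => exists_equation p.2
  have hu0 : ∀ i, IsUnit (PowerSeries.coeff 0 (u i)) := fun i => by
    rw [PowerSeries.coeff_zero_eq_constantCoeff_apply]
    exact ((Pi.isUnit_iff.1 hu) i).map _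
  choose v hv using fun i => (hu0 i).exists_left_inv
  let F : Fin d × ℕ → (Fin d × ℕ → R) → R := fun p x =>
    if h : IsLeading O p then
      v p.1 * ((if position p = 0 then 1 else 0) -
        ∑ l ∈ Finset.range p.2, PowerSeries.coeff (p.2 - l) (u p.1) * x (p.1, l))
    else (a ⟨p, h⟩).sum fun q b => b • x q
  have hF : ∀ p x y, (∀ q, position q < position p → x q = y q) → F p x = F p y := by
    intro p x y hxy
    by_cases h : IsLeading O p
    · simp only [F, dif_pos h]
      congr 2
      refine Finset.sum_congr rfl fun l hl => ?_
      rw [hxy]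
      simp only [position]
      have hd : 0 < d := p.1.pos
      have : l < p.2 := by simpa using hl
      have := Nat.mul_lt_mul_of_pos_right this hd
      omega
    · simp only [F, dif_neg h]
      refine Finsupp.sum_congr fun q hq => ?_
      rw [hxy q (ha ⟨p, h⟩ q (by simpa using hq))]
  have hlin : ∀ (p : Gap O) (z : Fin d → PowerSeries R),
      linForm (Finsupp.single p.1 1 - a p) z = PowerSeries.coeff p.1.2 (z p.1.1) -
        (a p).sum fun q b => b • PowerSeries.coeff q.2 (z q.1) := by
    intro p z
    rw [linForm_sub, linForm_single]
    rfl
  have hmul : ∀ (p : Fin d × ℕ) (z : Fin d → PowerSeries R),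
      PowerSeries.coeff p.2 ((u * z) p.1) =
        (∑ l ∈ Finset.range p.2, PowerSeries.coeff (p.2 - l) (u p.1) *
          PowerSeries.coeff l (z p.1)) +
        PowerSeries.coeff 0 (u p.1) * PowerSeries.coeff p.2 (z p.1) := by
    intro p z
    rw [Pi.mul_apply, mul_comm, PowerSeries.coeff_mul,
      Finset.Nat.sum_antidiagonal_eq_sum_range_succ
        (fun i j => PowerSeries.coeff i (z p.1) * PowerSeries.coeff j (u p.1)),
      Finset.sum_range_succ, Nat.sub_self, mul_comm (PowerSeries.coeff p.2 (z p.1))]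
    congr 1
    exact Finset.sum_congr rfl fun l _ => mul_comm _ _
  have hiff : ∀ z : Fin d → PowerSeries R, (z ∈ points O R ∧ ∀ p : Fin d × ℕ, IsLeading O p →
      PowerSeries.coeff p.2 ((u * z) p.1) = if position p = 0 then 1 else 0) ↔
      ∀ p : Fin d × ℕ, PowerSeries.coeff p.2 (z p.1) =
        F p fun q => PowerSeries.coeff q.2 (z q.1) := by
    intro z
    constructor
    · rintro ⟨h1, h2⟩ p
      by_cases h : IsLeading O p
      · simp only [F, dif_pos h]
        rw [← h2 p h, hmul, add_sub_cancel_left, ← mul_assoc, hv, one_mul]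
      · simp only [F, dif_neg h]
        have := h1 _ (hae ⟨p, h⟩)
        rwa [hlin, sub_eq_zero] at this
    · intro h1
      refine ⟨mem_points_of_gap a ha hae z fun p => ?_, fun p hp => ?_⟩
      · rw [hlin, h1 p.1]
        simp only [F, dif_neg p.2]
        exact sub_self _
      · have h2 := h1 p
        simp only [F, dif_pos hp] at h2
        have h3 := hv p.1
        rw [hmul, h2, ← mul_assoc, mul_comm _ (v p.1), h3, one_mul]
        exact add_sub_cancel _ _
  obtain ⟨x, hx, hxu⟩ := existsUnique_solve F hF
  refine ⟨fun i => PowerSeries.mk fun j => x (i, j), ?_, fun z hz => ?_⟩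
  · refine (hiff _).2 fun p => ?_
    simp only [PowerSeries.coeff_mk]
    exact hx p
  · have := hxu (fun q => PowerSeries.coeff q.2 (z q.1)) ((hiff z).1 hz)
    funext i
    ext j
    rw [PowerSeries.coeff_mk, ← this]

/-- `𝒥` represents the classes of units of `∏ R⟦t_i⟧` modulo the units of `O(R)`, and the universal
polynomial representative gives exactly one representative in each class. -/
theorem existsUnique_representative {O : Subalgebra k (Fin d → PowerSeries k)}
    (hO : IsCurveSingularityRing O) {R : Type*} [CommRing R] [Algebra k R]
    (u : Fin d → PowerSeries R) (hu : IsUnit u) :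
    ∃! φ : JRing O →ₐ[k] R, ∃ w ∈ points O R, IsUnit w ∧
      (fun i => PowerSeries.map φ.toRingHom (univRep O i)) = u * w := by
  classical
  have hφ : ∀ (φ : JRing O →ₐ[k] R) (p : Fin d × ℕ),
      PowerSeries.coeff p.2 (PowerSeries.map φ.toRingHom (univRep O p.1)) =
        φ (algebraMap _ _ (repCoeff O p)) := fun φ p => by
    rw [PowerSeries.coeff_map, univRep, PowerSeries.coeff_mk]
    rfl
  obtain ⟨w, ⟨hw, hlead⟩, hwu⟩ := existsUnique_mul (O := O) u hu
  set v := u * w with hv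
  have hw0 : ∀ i, PowerSeries.coeff 0 (w i) =
      PowerSeries.coeff 0 (w ⟨0, i.pos⟩) := by
    intro i
    have h := hw (Finsupp.single (i, 0) (1 : k) - Finsupp.single (⟨0, i.pos⟩, 0) (1 : k)) (by
      intro y hy
      rw [linForm_sub, linForm_single, linForm_single]
      have h3 := coeff_zero_eq hO (O.sub_mem hy (O.algebraMap_mem
        (PowerSeries.coeff 0 (y ⟨0, i.pos⟩)))) ⟨0, i.pos⟩ i (by
          simp [Pi.algebraMap_apply])
      simpa [Pi.algebraMap_apply, PowerSeries.algebraMap_apply] using h3)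
    rw [linForm_sub, linForm_single, linForm_single] at h
    exact sub_eq_zero.1 h
  have hwunit : IsUnit w := by
    rw [Pi.isUnit_iff]
    intro i
    rw [PowerSeries.isUnit_iff_constantCoeff, ← PowerSeries.coeff_zero_eq_constantCoeff_apply,
      hw0 i]
    have hz : position ((⟨0, i.pos⟩ : Fin d), 0) = 0 := by simp [position]
    have h := hlead (⟨0, i.pos⟩, 0) (isLeading_of_position_eq_zero O hz)
    rw [if_pos hz, hv, Pi.mul_apply, PowerSeries.coeff_zero_eq_constantCoeff_apply, map_mul,
      ← PowerSeries.coeff_zero_eq_constantCoeff_apply,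
      ← PowerSeries.coeff_zero_eq_constantCoeff_apply] at h
    exact IsUnit.of_mul_eq_one_right _ h
  have hvunit : IsUnit v := hu.mul hwunit
  let g : MvPolynomial (Gap O) k →ₐ[k] R :=
    MvPolynomial.aeval fun p => PowerSeries.coeff p.1.2 (v p.1.1)
  have hg : ∀ p : Fin d × ℕ, g (repCoeff O p) = PowerSeries.coeff p.2 (v p.1) := by
    intro p
    by_cases h : IsLeading O p
    · rw [hlead p h, repCoeff, dif_pos h]
      split_ifs <;> simp
    · rw [repCoeff, dif_neg h]
      simp [g]
  have hgu : IsUnit (g (∏ i : Fin d, repCoeff O (i, 0))) := by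
    rw [map_prod]
    refine IsUnit.prod_univ_iff.2 fun i => ?_
    rw [hg]
    simp only [PowerSeries.coeff_zero_eq_constantCoeff_apply]
    exact ((Pi.isUnit_iff.1 hvunit) i).map _
  refine ⟨IsLocalization.liftAlgHom (M := Submonoid.powers (∏ i : Fin d, repCoeff O (i, 0)))
    (f := g) (by
      rintro ⟨_, n, rfl⟩
      rw [map_pow]
      exact hgu.pow n), ⟨w, hw, hwunit, ?_⟩, ?_⟩
  · funext i
    ext j
    rw [hφ _ (i, j), IsLocalization.liftAlgHom_apply, IsLocalization.lift_eq]
    exact hg (i, j)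
  · rintro φ ⟨w', hw', _, hφw⟩
    have hw'' : w' = w := by
      refine hwu w' ⟨hw', fun p hp => ?_⟩
      rw [← hφw, hφ, repCoeff, dif_pos hp]
      split_ifs <;> simp
    rw [hw''] at hφw
    refine IsLocalization.algHom_ext (Submonoid.powers (∏ i : Fin d, repCoeff O (i, 0))) ?_
    refine MvPolynomial.algHom_ext fun p => ?_
    have h1 := hφ φ p.1
    rw [congrFun hφw p.1.1, repCoeff, dif_neg p.2] at h1
    have h2 : ∀ ψ : JRing O →ₐ[k] R, (ψ.comp (Algebra.algHom k (MvPolynomial (Gap O) k)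
        (JRing O))) (MvPolynomial.X p) = ψ (algebraMap _ _ (MvPolynomial.X p)) := fun _ => rfl
    rw [h2, h2, ← h1, IsLocalization.liftAlgHom_apply, IsLocalization.lift_eq]
    have h3 := hg p.1
    rw [repCoeff, dif_neg p.2] at h3
    exact h3.symm

/-- `O` contains `t^N Õ` for some `N`. -/
theorem exists_conductor_bound {O : Subalgebra k (Fin d → PowerSeries k)}
    (hO : IsCurveSingularityRing O) : ∃ N : ℕ, ∀ z : Fin d → PowerSeries k,
      (∀ i, ∀ j < N, PowerSeries.coeff j (z i) = 0) → z ∈ O := by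
  classical
  have := hO.finite_codim
  let mk := (Subalgebra.toSubmodule O).mkQ
  have hmk : ∀ y, mk y = 0 ↔ y ∈ O := fun y => by
    simp [mk]
  obtain ⟨r, s, hs⟩ := Module.Finite.exists_fin (R := k)
    (M := (Fin d → PowerSeries k) ⧸ Subalgebra.toSubmodule O)
  choose y hy using fun l => Submodule.mkQ_surjective (Subalgebra.toSubmodule O) (s l)
  have hideal : ∀ x ∈ O, (∀ l, x * y l ∈ O) → ∀ z, x * z ∈ O := by
    intro x hx hxy z
    have hz : mk z ∈ Submodule.span k (Set.range s) := hs ▸ Submodule.mem_top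
    obtain ⟨b, hb⟩ := (Submodule.mem_span_range_iff_exists_fun k).1 hz
    have h1 : z - ∑ l, b l • y l ∈ O := by
      rw [← hmk, map_sub, map_sum, ← hb, sub_eq_zero]
      refine Finset.sum_congr rfl fun l _ => ?_
      rw [map_smul, ← hy l]
    have h2 : x * z = x * (z - ∑ l, b l • y l) + ∑ l, b l • (x * y l) := by
      rw [mul_sub, Finset.mul_sum]
      simp
    rw [h2]
    exact O.add_mem (O.mul_mem hx h1) (O.sum_mem fun l _ => O.smul_mem (hxy l) _)
  have hpow : ∀ i : Fin d, ∃ e : ℕ, ∀ w : PowerSeries k,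
      Pi.single i (PowerSeries.X ^ e * w) ∈ O := by
    intro i
    let ι : Polynomial k →ₗ[k] (Fin d → PowerSeries k) :=
      (LinearMap.single k (fun _ : Fin d => PowerSeries k) i).comp
        (Polynomial.coeToPowerSeries.algHom (R := k) k).toLinearMap
    let T : Polynomial k →ₗ[k] (Option (Fin r) →
        (Fin d → PowerSeries k) ⧸ Subalgebra.toSubmodule O) :=
      LinearMap.pi fun l => mk.comp ((LinearMap.mulRight k (l.elim 1 y)).comp ι)
    have hT : ¬ Function.Injective T := fun h =>
      Polynomial.not_finite (R := k) (Module.Finite.of_injective T h)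
    rw [← LinearMap.ker_eq_bot, Submodule.eq_bot_iff] at hT
    push Not at hT
    obtain ⟨p, hp, hp0⟩ := hT
    have hp' : ∀ l : Option (Fin r), ι p * (l.elim 1 y) ∈ O := fun l => by
      rw [← hmk]
      exact congrFun hp l
    have hpO := hideal (ι p) (by simpa using hp' none) (fun l => hp' (some l))
    have hιp : ι p = Pi.single i (p : PowerSeries k) := by
      simp [ι]
    have hne : (p : PowerSeries k) ≠ 0 := by simpa using hp0
    refine ⟨(p : PowerSeries k).order.toNat, fun w => ?_⟩
    have h3 := PowerSeries.X_pow_order_mul_divXPowOrder (f := (p : PowerSeries k))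
    rw [← PowerSeries.Unit_of_divided_by_X_pow_order_nonzero hne] at h3
    set v := PowerSeries.Unit_of_divided_by_X_pow_order (p : PowerSeries k)
    have h1 := hpO (Pi.single i ((v⁻¹).val * w))
    rw [hιp, ← Pi.single_mul] at h1
    have h2 : (p : PowerSeries k) * ((v⁻¹).val * w) =
        PowerSeries.X ^ (p : PowerSeries k).order.toNat * w := by
      nth_rewrite 1 [← h3]
      rw [mul_assoc, Units.mul_inv_cancel_left]
    rwa [h2] at h1
  choose e he using hpow
  refine ⟨Finset.univ.sup e, fun z hz => ?_⟩
  have h1 : ∀ i, ∃ w, z i = PowerSeries.X ^ e i * w := fun i => by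
    have : PowerSeries.X ^ e i ∣ z i := PowerSeries.X_pow_dvd_iff.2 fun j hj =>
      hz i j (lt_of_lt_of_le hj (Finset.le_sup (Finset.mem_univ i)))
    exact this
  choose w hw using h1
  have h2 : z = ∑ i, Pi.single i (z i) := (Finset.univ_sum_single z).symm
  rw [h2]
  refine O.sum_mem fun i _ => ?_
  rw [hw]
  exact he i (w i)

/-- `O` is the solution set of the system `Δ = 0`. -/
theorem points_self {O : Subalgebra k (Fin d → PowerSeries k)}
    (hO : IsCurveSingularityRing O) : points O k = (O : Set (Fin d → PowerSeries k)) := by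
  classical
  refine Set.Subset.antisymm (fun z hz => ?_) (fun z hz a ha => ha z hz)
  obtain ⟨N, hN⟩ := exists_conductor_bound hO
  by_contra hzO
  obtain ⟨f, hfz, hf⟩ := Submodule.exists_le_ker_of_notMem
    (p := Subalgebra.toSubmodule O) (v := z) hzO
  let s : Finset (Fin d × ℕ) := Finset.univ ×ˢ Finset.range N
  let E : Fin d × ℕ → (Fin d → PowerSeries k) := fun p =>
    Pi.single p.1 (PowerSeries.monomial p.2 1)
  let a : (Fin d × ℕ) →₀ k := Finsupp.onFinset s (fun p => if p ∈ s then f (E p) else 0)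
    fun p hp => by
      by_contra h
      exact hp (if_neg h)
  have ha : ∀ y : Fin d → PowerSeries k, linForm a y = f y := by
    intro y
    have h1 : y - ∑ p ∈ s, PowerSeries.coeff p.2 (y p.1) • E p ∈ O := by
      refine hN _ fun i j hj => ?_
      rw [Pi.sub_apply, map_sub, Finset.sum_apply, map_sum, sub_eq_zero,
        Finset.sum_eq_single (i, j)]
      · simp [E]
      · rintro ⟨i', j'⟩ _ hne
        by_cases hi : i' = i
        · subst hi
          have : j ≠ j' := fun h => hne (by rw [h])
          simp [E, PowerSeries.coeff_monomial, this]
        · simp [E, Pi.single_eq_of_ne (Ne.symm hi)]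
      · intro h
        exact absurd (Finset.mem_product.2 ⟨Finset.mem_univ i, Finset.mem_range.2 hj⟩) h
    have h2 : f (y - ∑ p ∈ s, PowerSeries.coeff p.2 (y p.1) • E p) = 0 := hf h1
    rw [map_sub, map_sum, sub_eq_zero] at h2
    rw [h2, linForm, Finsupp.onFinset_sum _ (by simp)]
    refine Finset.sum_congr rfl fun p hp => ?_
    rw [if_pos hp, map_smul, smul_eq_mul, smul_eq_mul, mul_comm]
  exact hfz ((ha z).symm.trans (hz a fun y hy => (ha y).trans (hf hy)))

/-- The set of principal ideals of `O` generated by an element of value `n`. -/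
def principalIdeals (O : Subalgebra k (Fin d → PowerSeries k)) (n : Fin d → ℕ) : Set (Ideal O) :=
  {I | ∃ z : O, (∀ i, (z.1 i).order = n i) ∧ I = Ideal.span {z}}

/-- The element `t^n μ` of `∏ k⟦t_i⟧`, for the representative `μ` given by a rational point. -/
noncomputable def pointGenerator {O : Subalgebra k (Fin d → PowerSeries k)} {n : Fin d → ℕ}
    (ψ : IRing O n →ₐ[k] k) : Fin d → PowerSeries k :=
  fun i => PowerSeries.X ^ n i *
    PowerSeries.map (ψ.comp (Ideal.Quotient.mkₐ k _)).toRingHom (univRep O i)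

theorem linForm_map {R R' : Type*} [CommRing R] [Algebra k R] [CommRing R'] [Algebra k R']
    (φ : R →ₐ[k] R') (a : (Fin d × ℕ) →₀ k) (z : Fin d → PowerSeries R) :
    linForm a (fun i => PowerSeries.map φ.toRingHom (z i)) = φ (linForm a z) := by
  simp only [linForm, Finsupp.sum, map_sum, map_smul]
  rfl

theorem isUnit_of_isUnit {O : Subalgebra k (Fin d → PowerSeries k)}
    (hO : IsCurveSingularityRing O) (w : O) (hw : IsUnit w.1) : IsUnit w := by
  have := hO.isLocalRing
  by_contra h
  have hd : 0 < d := by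
    rcases Nat.eq_zero_or_pos d with rfl | h0
    · exact absurd (isUnit_of_subsingleton w) h
    · exact h0
  let i : Fin d := ⟨0, hd⟩
  have h1 : IsUnit (PowerSeries.constantCoeff (w.1 i)) := ((Pi.isUnit_iff.1 hw) i).map _
  set b := PowerSeries.constantCoeff (w.1 i) with hb
  have h2 : ¬ IsUnit (algebraMap k O b - w) := by
    intro hu
    have h3 : IsUnit (PowerSeries.constantCoeff ((algebraMap k O b - w).1 i)) :=
      hu.map (((PowerSeries.constantCoeff (R := k)).comp
        (Pi.evalRingHom (fun _ : Fin d => PowerSeries k) i)).comp O.val.toRingHom)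
    have h4 : (algebraMap k O b - w).1 i = PowerSeries.C b - w.1 i := rfl
    rw [h4, map_sub, PowerSeries.constantCoeff_C, ← hb, sub_self] at h3
    simp at h3
  have h5 := IsLocalRing.nonunits_add h h2
  rw [add_sub_cancel] at h5
  exact h5 (h1.map (algebraMap k O))

/-- The rational points of `ℐ_n` are the principal ideals of `O` generated by an element of
value `n`: the point with representative `μ` corresponds to the ideal `t^n μ O`. -/
theorem exists_points_equiv {O : Subalgebra k (Fin d → PowerSeries k)}
    (hO : IsCurveSingularityRing O) (n : Fin d → ℕ) :
    ∃ e : (IRing O n →ₐ[k] k) ≃ principalIdeals O n, ∀ ψ, ∃ h : pointGenerator ψ ∈ O,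
      (e ψ).1 = Ideal.span {⟨pointGenerator ψ, h⟩} := by
  have hμ : ∀ φ : JRing O →ₐ[k] k,
      IsUnit (fun i => PowerSeries.map φ.toRingHom (univRep O i)) := by
    intro φ
    rw [Pi.isUnit_iff]
    intro i
    rw [PowerSeries.isUnit_iff_constantCoeff, ← PowerSeries.coeff_zero_eq_constantCoeff_apply,
      PowerSeries.coeff_map, univRep, PowerSeries.coeff_mk]
    have h1 : IsUnit (algebraMap _ (JRing O) (∏ i : Fin d, repCoeff O (i, 0))) :=
      IsLocalization.Away.algebraMap_isUnit _
    rw [map_prod] at h1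
    exact (IsUnit.prod_univ_iff.1 h1 i).map _
  have hmem : ∀ ψ : IRing O n →ₐ[k] k, pointGenerator ψ ∈ O := by
    intro ψ
    have h : pointGenerator ψ ∈ points O k := by
      intro a ha
      have h1 := linForm_map (ψ.comp (Ideal.Quotient.mkₐ k _)) a
        (fun i => PowerSeries.X ^ n i * univRep O i)
      simp only [map_mul, map_pow, PowerSeries.map_X] at h1
      refine h1.trans ?_
      rw [AlgHom.comp_apply, Ideal.Quotient.mkₐ_eq_mk, Ideal.Quotient.eq_zero_iff_mem.2, map_zero]
      exact Ideal.subset_span ⟨a, ha, rfl⟩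
    rwa [points_self hO] at h
  have hord : ∀ (ψ : IRing O n →ₐ[k] k) i, (pointGenerator ψ i).order = n i := by
    intro ψ i
    rw [pointGenerator, PowerSeries.order_mul, PowerSeries.order_X_pow,
      PowerSeries.order_zero_of_unit ((Pi.isUnit_iff.1 (hμ _)) i), add_zero]
  let f : (IRing O n →ₐ[k] k) → principalIdeals O n := fun ψ =>
    ⟨Ideal.span {⟨pointGenerator ψ, hmem ψ⟩}, _, hord ψ, rfl⟩
  have hXne : ∀ i, (PowerSeries.X : PowerSeries k) ^ n i ≠ 0 := fun i =>
    pow_ne_zero _ PowerSeries.X_ne_zero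
  have hf : Function.Bijective f := by
    constructor
    · intro ψ ψ' h
      have h1 : Ideal.span {(⟨pointGenerator ψ, hmem ψ⟩ : O)} =
        Ideal.span {⟨pointGenerator ψ', hmem ψ'⟩} := congrArg Subtype.val h
      obtain ⟨w, hw⟩ := Ideal.mem_span_singleton.1
        (h1 ▸ Ideal.mem_span_singleton_self (⟨pointGenerator ψ, hmem ψ⟩ : O))
      have hw' : pointGenerator ψ = pointGenerator ψ' * w.1 := congrArg Subtype.val hw
      set φ := ψ.comp (Ideal.Quotient.mkₐ k _) with hφ
      set φ' := ψ'.comp (Ideal.Quotient.mkₐ k _) with hφ'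
      have h2 : (fun i => PowerSeries.map φ.toRingHom (univRep O i)) =
          (fun i => PowerSeries.map φ'.toRingHom (univRep O i)) * w.1 := by
        funext i
        have h3 := congrFun hw' i
        simp only [pointGenerator, Pi.mul_apply, mul_assoc] at h3
        exact mul_left_cancel₀ (hXne i) h3
      have hwu : IsUnit w.1 := isUnit_of_mul_isUnit_right (h2 ▸ hμ φ)
      have h4 : φ = φ' := by
        refine (existsUnique_representative hO _ (hμ φ')).unique
          ⟨w.1, ?_, hwu, h2⟩ ⟨1, ?_, isUnit_one, (mul_one _).symm⟩
        · rw [points_self hO]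
          exact w.2
        · rw [points_self hO]
          exact O.one_mem
      exact AlgHom.cancel_right (Ideal.Quotient.mkₐ_surjective k _) |>.1 h4
    · rintro ⟨_, z, hz, rfl⟩
      have h1 : ∀ i, ∃ u, IsUnit u ∧ z.1 i = PowerSeries.X ^ n i * u := by
        intro i
        have hne : z.1 i ≠ 0 := by
          intro h
          have := hz i
          rw [h, PowerSeries.order_zero] at this
          exact absurd this (ENat.natCast_ne_top _).symm
        refine ⟨PowerSeries.divXPowOrder (z.1 i), ?_, ?_⟩
        · rw [← PowerSeries.Unit_of_divided_by_X_pow_order_nonzero hne]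
          exact Units.isUnit _
        · conv_lhs => rw [← PowerSeries.X_pow_order_mul_divXPowOrder (f := z.1 i)]
          rw [hz i, ENat.toNat_natCast]
      choose u hu hzu using h1
      obtain ⟨φ, ⟨w, hw, hwu, hφ⟩, -⟩ :=
        existsUnique_representative hO u (Pi.isUnit_iff.2 hu)
      rw [points_self hO] at hw
      have h2 : (fun i => PowerSeries.X ^ n i * PowerSeries.map φ.toRingHom (univRep O i)) =
          z.1 * w := by
        funext i
        rw [congrFun hφ i, Pi.mul_apply, Pi.mul_apply, hzu i, mul_assoc]
      let ψ : IRing O n →ₐ[k] k := Ideal.Quotient.liftₐ _ φ (by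
        intro r hr
        have hle : Ideal.span {r : JRing O | ∃ a, IsEquation O a ∧
            r = linForm a (fun i => PowerSeries.X ^ n i * univRep O i)} ≤
            RingHom.ker φ := by
          rw [Ideal.span_le]
          rintro _ ⟨a, ha, rfl⟩
          have h3 := linForm_map φ a (fun i => PowerSeries.X ^ n i * univRep O i)
          simp only [map_mul, map_pow, PowerSeries.map_X] at h3
          rw [h2] at h3
          exact h3.symm.trans (ha _ (O.mul_mem z.2 hw))
        exact hle hr)
      have hψ : pointGenerator ψ = z.1 * w := h2
      refine ⟨ψ, Subtype.ext ?_⟩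
      change Ideal.span {(⟨pointGenerator ψ, hmem ψ⟩ : O)} = Ideal.span {z}
      rw [← Ideal.span_singleton_mul_right_unit (isUnit_of_isUnit hO ⟨w, hw⟩ hwu) z]
      congr 2
      exact Subtype.ext hψ
  exact ⟨Equiv.ofBijective f hf, fun ψ => ⟨hmem ψ, rfl⟩⟩

end Representatives

/-- The variety `𝒥`. -/
noncomputable def JVariety {O : Subalgebra k (Fin d → PowerSeries k)}
    (hO : IsCurveSingularityRing O) : Variety k :=
  have := finiteType_JRing hO
  affineVariety k (JRing O)

/-- The variety `ℐ_n`. -/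
noncomputable def IVariety {O : Subalgebra k (Fin d → PowerSeries k)}
    (hO : IsCurveSingularityRing O) (n : Fin d → ℕ) : Variety k :=
  have := finiteType_IRing hO n
  affineVariety k (IRing O n)

/-! ### The zeta function -/

open Classical in
/-- `Z(T_1, …, T_d, O) = ∑_{n ∈ S} [ℐ_n] 𝕃^{-‖n‖} T^n`, as a power series over `ℳ_k`. -/
noncomputable def zeta {O : Subalgebra k (Fin d → PowerSeries k)}
    (hO : IsCurveSingularityRing O) : MvPowerSeries (Fin d) (MotivicRing k) :=
  fun n => if ⇑n ∈ semigroup O then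
    motivicClass k (IVariety hO n) * motLinv k ^ (∑ i, n i) else 0

variable (k) in
/-- The term `a 𝕃^{-‖n‖} T^n`. -/
noncomputable def term (a : MotivicRing k) (n : Fin d → ℕ) :
    MvPowerSeries (Fin d) (MotivicRing k) :=
  MvPowerSeries.monomial (Finsupp.equivFunOnFinite.symm n) (a * motLinv k ^ (∑ i, n i))

variable (k) in
/-- `∏_{j ∈ J} (1 - 𝕃⁻¹ T_j)`. -/
noncomputable def denom (J : Finset (Fin d)) : MvPowerSeries (Fin d) (MotivicRing k) :=
  ∏ j ∈ J, (1 - MvPowerSeries.C (motLinv k) * MvPowerSeries.X j)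

variable (k) in
/-- `1 / ∏_{j ∈ J} (1 - 𝕃⁻¹ T_j)`, see `denom_mul_invDenom`. -/
noncomputable def invDenom (J : Finset (Fin d)) : MvPowerSeries (Fin d) (MotivicRing k) :=
  MvPowerSeries.invOfUnit (denom k J) 1

theorem denom_mul_invDenom (J : Finset (Fin d)) : denom k J * invDenom k J = 1 := by
  refine MvPowerSeries.mul_invOfUnit _ _ ?_
  simp [denom]

/-- `H_{J,m}` for `m ∈ ℕ^{I₀ ∖ J}`: the elements `n` of `S` with `n_j ≥ c_j` for `j ∈ J` and
`n_j = m_j` for `j ∉ J`. -/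
def HSet (O : Subalgebra k (Fin d → PowerSeries k)) (c : Fin d → ℕ) (J : Finset (Fin d))
    (m : {i // i ∉ J} → ℕ) : Set (Fin d → ℕ) :=
  {n | n ∈ semigroup O ∧ (∀ j ∈ J, c j ≤ n j) ∧ ∀ j : {i // i ∉ J}, n j = m j}

open Classical in
/-- `B_J`: the tuples `m ∈ ℕ^{I₀ ∖ J}` with `m_j < c_j` and `H_{J,m}` nonempty. -/
noncomputable def BSet (O : Subalgebra k (Fin d → PowerSeries k)) (c : Fin d → ℕ)
    (J : Finset (Fin d)) : Finset ({i // i ∉ J} → ℕ) :=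
  {m ∈ Fintype.piFinset fun j : {i // i ∉ J} => Finset.range (c j) | (HSet O c J m).Nonempty}

/-- `f_J(m)`: the vector with entries `c_j` for `j ∈ J` and `m_j` for `j ∉ J`. -/
def fVec (c : Fin d → ℕ) (J : Finset (Fin d)) (m : {i // i ∉ J} → ℕ) : Fin d → ℕ :=
  fun i => if h : i ∈ J then c i else m ⟨i, h⟩

open Classical in
/-- The elements `n` of `S` with `n_i < c_i` for all `i`. -/
noncomputable def smallValues (O : Subalgebra k (Fin d → PowerSeries k)) (c : Fin d → ℕ) :
    Finset (Fin d → ℕ) :=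
  {n ∈ Fintype.piFinset fun i => Finset.range (c i) | n ∈ semigroup O}

end Ring
end MotivicZeta

open MotivicZeta

namespace MotivicZeta

universe u

/-! ### Classes of affine varieties -/

/-! Everything above the conductor is invisible to `O`. Since `t^c Õ ⊆ O` (`mem_of_coeff_eq_zero`),
a linear equation of `O` involves only coefficients of index below `c i` on branch `i`. Truncating a
value `n` to `n ⊓ c` therefore changes neither its membership in `S` (`inf_mem_semigroup_iff`) nor
the ideal cutting out `ℐ_n` (`valueIdeal_inf`), so `[ℐ_n]` depends on `n ⊓ c` alone.

Sort the exponents `n` by the set `J` of branches with `c i ≤ n i`. For fixed `J`, the values with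
the same truncation fill an orthant with corner `f_J(m)` and directions `J`. On it the class is
constant, and the weights `𝕃^{-‖n‖}` sum to a product of geometric series (`term_mul_invDenom`). The
set `J = ∅` gives the finite sum, and `J = I₀` gives the last term because `ℐ_c = 𝒥`
(`valueIdeal_conductor`).

For the rational form, `invDenom_eq` brings all terms to one denominator. A branch outside `J`
contributes `m i` and one denominator factor, and `m i + 1 ≤ c i`; this yields the degree bound. At
`T_i = 𝕃` every factor `1 - 𝕃⁻¹ T_i` vanishes, so only the term `[𝒥]`, which carries no such factor,
survives. -/

theorem motivicClass_affineVariety_congr {k : Type u} [Field k] {A B : Type u} [CommRing A]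
    [Algebra k A] [Algebra.FiniteType k A] [CommRing B] [Algebra k B] [Algebra.FiniteType k B]
    (e : A ≃ₐ[k] B) :
    motivicClass k (affineVariety k A) = motivicClass k (affineVariety k B) := by
  have hiso : Nonempty ((affineVariety k A).toOver ≅ (affineVariety k B).toOver) := by
    -- `Spec` reverses arrows, so the map from `Spec A` to `Spec B` comes from `e.symm`.
    refine ⟨Over.isoMk (Scheme.Spec.mapIso e.toRingEquiv.toCommRingCatIso.symm.op) ?_⟩
    change Spec.map (CommRingCat.ofHom _) ≫ Spec.map (CommRingCat.ofHom _) =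
      Spec.map (CommRingCat.ofHom _)
    rw [← Spec.map_comp, ← CommRingCat.ofHom_comp]
    congr 2
    ext x
    exact e.symm.commutes x
  obtain ⟨i⟩ := hiso
  unfold motivicClass
  congr 1
  exact Ideal.Quotient.eq.2 (Ideal.subset_span (K0Rel.iso _ _ i))

/-! ### Truncation of values at the conductor -/

section Conductor

variable {k : Type u} [Field k] {d : ℕ} {O : Subalgebra k (Fin d → PowerSeries k)}
  {c : Fin d → ℕ}

/-- For `d = 0` the ambient product is the zero ring, which has no local subalgebra. Positivity
separates the cases `J = ∅` and `J = univ`, and gives the full denominator at least one factor. -/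
theorem IsCurveSingularityRing.dim_pos (hO : IsCurveSingularityRing O) : 0 < d := by
  have := hO.isLocalRing
  rcases Nat.eq_zero_or_pos d with rfl | h
  · exact absurd (Subsingleton.elim (0 : O) 1) zero_ne_one
  · exact h

theorem IsConductor.mem_of_le (hc : IsConductor O c) {n : Fin d → ℕ} (hn : c ≤ n) :
    n ∈ semigroup O := by
  have h := hc.prop (n - c)
  rwa [add_tsub_cancel_of_le hn] at h

/-- Membership is known for series vanishing below the bound `N` of `exists_conductor_bound`. Below
`N`, coefficients are killed one at a time: as `m ≥ c i`, there is an element of `O` of value `m` on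
branch `i` and so large elsewhere that its other components can be removed within `O`. -/
theorem single_mem_of_isConductor (hO : IsCurveSingularityRing O) (hc : IsConductor O c)
    (i : Fin d) (w : PowerSeries k) (hw : ∀ j < c i, PowerSeries.coeff j w = 0) :
    (Pi.single i w : Fin d → PowerSeries k) ∈ O := by
  obtain ⟨N, hN⟩ := exists_conductor_bound hO
  have hsingle : ∀ w : PowerSeries k, (∀ j < N, PowerSeries.coeff j w = 0) →
      (Pi.single i w : Fin d → PowerSeries k) ∈ O := by
    intro v hv
    refine hN _ fun i' j hj => ?_
    by_cases h : i' = i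
    · subst h
      simpa using hv j hj
    · simp [Pi.single_eq_of_ne h]
  -- Here `e` bounds the number of coefficients still to be killed between `m` and `N`.
  suffices ∀ e m : ℕ, c i ≤ m → N ≤ m + e → ∀ w : PowerSeries k,
      (∀ j < m, PowerSeries.coeff j w = 0) → (Pi.single i w : Fin d → PowerSeries k) ∈ O from
    this N (c i) le_rfl (Nat.le_add_left _ _) w hw
  intro e
  induction e with
  | zero => exact fun m _ hm w hw => hsingle w fun j hj => hw j (by omega)
  | succ e ih =>
    intro m hcm hm w hw
    -- On the other branches the summand `c j` keeps the value above the conductor, and `N` puts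
    -- those components of `z` into `O`.
    obtain ⟨z, hz, hord⟩ := hc.mem_of_le (n := Function.update (fun j => c j + N) i m) (by
      intro j
      by_cases h : j = i
      · subst h
        simpa using hcm
      · simp [Function.update_of_ne h])
    have hzi : (z i).order = m := by simpa using hord i
    have hzS : (Pi.single i (z i) : Fin d → PowerSeries k) ∈ O := by
      have h1 : z - Pi.single i (z i) ∈ O := by
        refine hN _ fun i' j hj => ?_
        by_cases h : i' = i
        · subst h
          simp
        · have h2 := hord i'
          rw [Function.update_of_ne h] at h2
          rw [Pi.sub_apply, Pi.single_eq_of_ne h, sub_zero]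
          refine PowerSeries.coeff_of_lt_order j ?_
          rw [h2]
          exact_mod_cast (by omega : j < c i' + N)
      simpa using O.sub_mem hz h1
    have hne : PowerSeries.coeff m (z i) ≠ 0 := ((PowerSeries.order_eq_nat).1 hzi).1
    have hlt : ∀ j < m, PowerSeries.coeff j (z i) = 0 := ((PowerSeries.order_eq_nat).1 hzi).2
    -- The scalar cancels the coefficient of index `m`, so that `w - b • z i` vanishes below `m +
    -- 1`.
    set b := PowerSeries.coeff m w / PowerSeries.coeff m (z i) with hb
    have h3 := ih (m + 1) (by omega) (by omega) (w - b • z i) (by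
      intro j hj
      rw [map_sub, map_smul, smul_eq_mul]
      rcases Nat.lt_succ_iff_lt_or_eq.1 hj with h | rfl
      · rw [hw j h, hlt j h, mul_zero, sub_zero]
      · rw [hb, div_mul_cancel₀ _ hne, sub_self])
    have h4 : (Pi.single i w : Fin d → PowerSeries k) =
        Pi.single i (w - b • z i) + b • (Pi.single i (z i) : Fin d → PowerSeries k) := by
      rw [← Pi.single_smul, ← Pi.single_add, sub_add_cancel]
    rw [h4]
    exact O.add_mem h3 (O.smul_mem hzS b)

/-- The conductor of the semigroup of values generates the conductor ideal: `t^c Õ ⊆ O`. -/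
theorem mem_of_coeff_eq_zero (hO : IsCurveSingularityRing O) (hc : IsConductor O c)
    (z : Fin d → PowerSeries k) (hz : ∀ i, ∀ j < c i, PowerSeries.coeff j (z i) = 0) : z ∈ O := by
  classical
  rw [← Finset.univ_sum_single z]
  exact O.sum_mem fun i _ => single_mem_of_isConductor hO hc i _ (hz i)

/-- Beyond the conductor a single monomial already lies in `O`, and the equation evaluates on it to
the coefficient `a p`. -/
theorem IsEquation.apply_eq_zero (hO : IsCurveSingularityRing O) (hc : IsConductor O c)
    {a : (Fin d × ℕ) →₀ k} (ha : IsEquation O a) {p : Fin d × ℕ} (hp : c p.1 ≤ p.2) :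
    a p = 0 := by
  classical
  have h := ha (Pi.single p.1 (PowerSeries.monomial p.2 1)) (single_mem_of_isConductor hO hc _ _
    fun j hj => by rw [PowerSeries.coeff_monomial, if_neg (by omega)])
  rw [linForm, Finsupp.sum, Finset.sum_eq_single p] at h
  · simpa using h
  · rintro ⟨i, j⟩ _ hne
    by_cases hi : i = p.1
    · subst hi
      have : j ≠ p.2 := fun h => hne (Prod.ext rfl h)
      simp [PowerSeries.coeff_monomial, this]
    · simp [Pi.single_eq_of_ne hi]
  · intro h'
    rw [Finsupp.notMem_support_iff.1 h', zero_smul]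

/-- The equations have coefficients in `k`, but the conclusion is needed over any `R`, in particular
for the universal representative over `JRing O`. -/
theorem IsEquation.linForm_congr (hO : IsCurveSingularityRing O) (hc : IsConductor O c)
    {a : (Fin d × ℕ) →₀ k} (ha : IsEquation O a) {R : Type*} [CommRing R] [Algebra k R]
    {z z' : Fin d → PowerSeries R}
    (h : ∀ i, ∀ j < c i, PowerSeries.coeff j (z i) = PowerSeries.coeff j (z' i)) :
    linForm a z = linForm a z' := by
  refine Finsupp.sum_congr fun p hp => ?_
  rw [h]
  by_contra hlt
  exact Finsupp.mem_support_iff.1 hp (ha.apply_eq_zero hO hc (not_lt.1 hlt))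

theorem coeff_X_pow_inf_mul {R : Type*} [CommRing R] (n c : ℕ) (f : PowerSeries R) {j : ℕ}
    (hj : j < c) : PowerSeries.coeff j (PowerSeries.X ^ (n ⊓ c) * f) =
      PowerSeries.coeff j (PowerSeries.X ^ n * f) := by
  rcases le_total n c with h | h
  · rw [inf_eq_left.2 h]
  · rw [inf_eq_right.2 h, PowerSeries.coeff_X_pow_mul', PowerSeries.coeff_X_pow_mul',
      if_neg (by omega), if_neg (by omega)]

/-- The entries of a value above the conductor are irrelevant. -/
theorem inf_mem_semigroup_iff (hO : IsCurveSingularityRing O) (hc : IsConductor O c)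
    (n : Fin d → ℕ) : n ⊓ c ∈ semigroup O ↔ n ∈ semigroup O := by
  classical
  -- The condition is symmetric in `n` and `n'`, so both implications follow from one statement.
  have key : ∀ n n' : Fin d → ℕ, (∀ i, n i = n' i ∨ (c i ≤ n i ∧ c i ≤ n' i)) →
      n ∈ semigroup O → n' ∈ semigroup O := by
    rintro n n' h ⟨z, hz, hord⟩
    -- Where the values differ, both are at least `c i`, so replacing the component changes `z` only
    -- by an element of `t^c Õ`.
    set z' : Fin d → PowerSeries k := fun i => if n i = n' i then z i else PowerSeries.X ^ n' i
      with hz'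
    refine ⟨z', ?_, fun i => ?_⟩
    · rw [← sub_add_cancel z' z]
      refine O.add_mem (mem_of_coeff_eq_zero hO hc _ fun i j hj => ?_) hz
      by_cases hi : n i = n' i
      · simp [hz', hi]
      · have h1 := (h i).resolve_left hi
        have h2 : PowerSeries.coeff j (z i) = 0 := by
          refine PowerSeries.coeff_of_lt_order j ?_
          rw [hord i]
          exact_mod_cast (by omega : j < n i)
        simp only [hz', Pi.sub_apply, if_neg hi, map_sub, h2, PowerSeries.coeff_X_pow, sub_zero]
        exact if_neg (by omega)
    · by_cases hi : n i = n' i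
      · simp only [hz', if_pos hi]
        rw [hord i, hi]
      · simp only [hz', if_neg hi]
        exact PowerSeries.order_X_pow _
  constructor
  · refine key _ _ fun i => ?_
    rw [Pi.inf_apply]
    omega
  · refine key _ _ fun i => ?_
    rw [Pi.inf_apply]
    omega

/-- The ideal of `JRing O` that defines `ℐ_n`. -/
noncomputable abbrev valueIdeal (O : Subalgebra k (Fin d → PowerSeries k)) (n : Fin d → ℕ) : Ideal (JRing O) :=
  Ideal.span {r : JRing O | ∃ a, IsEquation O a ∧
    r = linForm a (fun i => PowerSeries.X ^ n i * univRep O i)}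

/-- The generators coincide one by one, since `t^(n ⊓ c) μ` and `t^n μ` have the same coefficients
below `c`. Thus the two closed subschemes of `𝒥` are equal, which is more than equality of their
classes. -/
theorem valueIdeal_inf (hO : IsCurveSingularityRing O) (hc : IsConductor O c) (n : Fin d → ℕ) :
    valueIdeal O (n ⊓ c) = valueIdeal O n := by
  have h : ∀ a, IsEquation O a → linForm a (fun i => PowerSeries.X ^ (n ⊓ c) i * univRep O i) =
      linForm a (fun i => PowerSeries.X ^ n i * univRep O i) := fun a ha =>
    ha.linForm_congr hO hc fun i j hj => coeff_X_pow_inf_mul _ _ _ hj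
  unfold valueIdeal
  congr 1
  ext r
  exact exists_congr fun a => and_congr_right fun ha => by rw [h a ha]

/-- All coefficients of `t^c μ` below `c` vanish, so every equation holds identically and `ℐ_c` is
all of `𝒥`. -/
theorem valueIdeal_conductor (hO : IsCurveSingularityRing O) (hc : IsConductor O c) :
    valueIdeal O c = ⊥ := by
  rw [valueIdeal, Ideal.span_eq_bot]
  rintro _ ⟨a, ha, rfl⟩
  rw [ha.linForm_congr hO hc (z' := 0) fun i j hj => ?_]
  · simp [linForm]
  · rw [PowerSeries.coeff_X_pow_mul', if_neg (by omega)]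
    simp

theorem motivicClass_IVariety_inf (hO : IsCurveSingularityRing O) (hc : IsConductor O c)
    (n : Fin d → ℕ) :
    motivicClass k (IVariety hO (n ⊓ c)) = motivicClass k (IVariety hO n) := by
  have := finiteType_IRing hO n
  have := finiteType_IRing hO (n ⊓ c)
  exact motivicClass_affineVariety_congr (Ideal.quotientEquivAlgOfEq k (valueIdeal_inf hO hc n))

theorem motivicClass_IVariety_conductor (hO : IsCurveSingularityRing O) (hc : IsConductor O c) :
    motivicClass k (IVariety hO c) = motivicClass k (JVariety hO) := by
  have := finiteType_IRing hO c
  have := finiteType_JRing hO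
  exact motivicClass_affineVariety_congr
    ((Ideal.quotientEquivAlgOfEq k (valueIdeal_conductor hO hc)).trans
      (AlgEquiv.quotientBot k (JRing O)))

end Conductor

/-! ### Rational power series -/

section PowerSeries

variable {k : Type u} [Field k] {d : ℕ}

theorem one_sub_C_motLinv_mul_X (j : Fin d) :
    (1 - MvPowerSeries.C (motLinv k) * MvPowerSeries.X j :
      MvPowerSeries (Fin d) (MotivicRing k)) =
      1 - MvPowerSeries.monomial (Finsupp.single j 1) (motLinv k) := by
  rw [MvPowerSeries.X_def, ← MvPowerSeries.monomial_zero_eq_C_apply,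
    MvPowerSeries.monomial_mul_monomial, zero_add, mul_one]

open Classical in
variable (k) in
/-- The expansion of `a 𝕃^{-‖f‖} T^f / ∏_{j ∈ J} (1 - 𝕃⁻¹ T_j)`. -/
noncomputable def orthant (J : Finset (Fin d)) (f : Fin d → ℕ) (a : MotivicRing k) :
    MvPowerSeries (Fin d) (MotivicRing k) :=
  fun n => if (∀ i ∉ J, n i = f i) ∧ f ≤ ⇑n then a * motLinv k ^ (∑ i, n i) else 0

theorem orthant_empty (f : Fin d → ℕ) (a : MotivicRing k) : orthant k ∅ f a = term k a f := by
  classical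
  ext n
  rw [term, MvPowerSeries.coeff_monomial]
  change ite _ _ _ = _
  have h : n = Finsupp.equivFunOnFinite.symm f ↔
      (∀ i ∉ (∅ : Finset (Fin d)), n i = f i) ∧ f ≤ ⇑n := by
    constructor
    · rintro rfl
      exact ⟨fun _ _ => rfl, le_rfl⟩
    · rintro ⟨h, -⟩
      exact Finsupp.ext fun i => h i (Finset.notMem_empty i)
  by_cases hn : n = Finsupp.equivFunOnFinite.symm f
  · rw [if_pos (h.1 hn), if_pos hn, hn]
    rfl
  · rw [if_neg (mt h.2 hn), if_neg hn]

/-- Geometric series in direction `j`: multiplying by `𝕃⁻¹ T_j` shifts the orthant one step along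
`j` and preserves the weights `𝕃^{-‖n‖}`, so the difference is the face where the `j`-th entry
equals `f j`. -/
theorem orthant_insert_mul {J : Finset (Fin d)} {j : Fin d} (hj : j ∉ J) (f : Fin d → ℕ)
    (a : MotivicRing k) :
    orthant k (insert j J) f a * (1 - MvPowerSeries.C (motLinv k) * MvPowerSeries.X j) =
      orthant k J f a := by
  classical
  ext n
  rw [one_sub_C_motLinv_mul_X, mul_sub, mul_one, map_sub, MvPowerSeries.coeff_mul_monomial]
  change ite _ _ _ - (ite _ (ite _ _ _ * _) _) = ite _ _ _
  by_cases hle : Finsupp.single j 1 ≤ n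
  -- From here on `n` is the exponent lowered by one in direction `j`.
  · obtain ⟨n, rfl⟩ := exists_add_of_le hle
    have hsum : ∑ i, (Finsupp.single j 1 + n : Fin d →₀ ℕ) i = (∑ i, n i) + 1 := by
      simp [Finset.sum_add_distrib, Finsupp.single_apply, add_comm]
    rw [if_pos hle, add_tsub_cancel_left, hsum]
    have happ : ∀ i, (Finsupp.single j 1 + n : Fin d →₀ ℕ) i = (if i = j then 1 else 0) + n i := by
      intro i
      simp [Finsupp.single_apply, eq_comm]
    simp only [Pi.le_def, happ, Finset.mem_insert, not_or]
    -- If the lowered exponent is still in the orthant, the two terms cancel, and the original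
    -- exponent is off the face.
    by_cases h1 : (∀ i, ¬ i = j ∧ i ∉ J → n i = f i) ∧ ∀ i, f i ≤ n i
    · have h2 : (∀ i, ¬ i = j ∧ i ∉ J → (if i = j then 1 else 0) + n i = f i) ∧
          ∀ i, f i ≤ (if i = j then 1 else 0) + n i := by
        refine ⟨fun i hi => ?_, fun i => (h1.2 i).trans (Nat.le_add_left _ _)⟩
        rw [if_neg hi.1, zero_add, h1.1 i hi]
      have h3 : ¬ ((∀ i ∉ J, (if i = j then 1 else 0) + n i = f i) ∧
          ∀ i, f i ≤ (if i = j then 1 else 0) + n i) := by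
        rintro ⟨h, -⟩
        have h4 := h j hj
        have h5 := h1.2 j
        rw [if_pos rfl] at h4
        omega
      rw [if_pos h1, if_pos h2, if_neg h3, pow_succ]
      ring
    -- Otherwise an original exponent in the orthant must lie on the face: a larger `j`-th entry
    -- could be lowered within the orthant.
    · rw [if_neg h1, zero_mul, sub_zero]
      refine if_congr ⟨fun h => ⟨fun i hi => ?_, h.2⟩,
        fun h => ⟨fun i hi => h.1 i hi.2, h.2⟩⟩ rfl rfl
      by_cases hij : i = j
      · subst hij
        have h6 := h.2 i
        rw [if_pos rfl] at h6 ⊢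
        by_contra hne
        refine h1 ⟨fun i' hi' => ?_, fun i' => ?_⟩
        · simpa [hi'.1] using h.1 i' hi'
        · by_cases hii : i' = i
          · subst hii
            omega
          · simpa [hii] using h.2 i'
      · exact h.1 i ⟨hij, hi⟩
  · rw [if_neg hle, sub_zero]
    -- No exponent can be lowered here, and `f ≤ n` forces `f j = 0 = n j`, which is again the face.
    have hnj : n j = 0 := by
      by_contra h
      exact hle (Finsupp.single_le_iff.2 (Nat.one_le_iff_ne_zero.2 h))
    refine if_congr ⟨fun h => ⟨fun i hi => ?_, h.2⟩,
      fun h => ⟨fun i hi => h.1 i fun h' => hi (Finset.mem_insert_of_mem h'), h.2⟩⟩ rfl rfl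
    by_cases hij : i = j
    · subst hij
      have h7 : f i ≤ n i := h.2 i
      omega
    · exact h.1 i (by simp [hij, hi])

theorem orthant_mul_denom (J : Finset (Fin d)) (f : Fin d → ℕ) (a : MotivicRing k) :
    orthant k J f a * denom k J = term k a f := by
  induction J using Finset.induction_on with
  | empty => rw [denom, Finset.prod_empty, mul_one, orthant_empty]
  | insert j J hj ih =>
    rw [denom, Finset.prod_insert hj, ← mul_assoc, orthant_insert_mul hj]
    exact ih

theorem term_mul_invDenom (J : Finset (Fin d)) (f : Fin d → ℕ) (a : MotivicRing k) :
    term k a f * invDenom k J = orthant k J f a := by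
  rw [← orthant_mul_denom J, mul_assoc, denom_mul_invDenom, mul_one]

/-- Passage to the common denominator: the factors over `Jᶜ` go into the numerator. -/
theorem invDenom_eq (J : Finset (Fin d)) :
    invDenom k J = denom k Jᶜ * invDenom k Finset.univ := by
  have h : denom k J * denom k Jᶜ = denom k Finset.univ := Finset.prod_mul_prod_compl _ _
  have h1 := denom_mul_invDenom (k := k) (Finset.univ : Finset (Fin d))
  have h2 := denom_mul_invDenom (k := k) J
  rw [← h] at h1
  linear_combination (-invDenom k J) * h1 + (denom k Jᶜ * invDenom k Finset.univ) * h2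

/-! ### Polynomial numerators: degree and value at `𝕃` -/

variable (k) in
/-- The polynomial `∏_{j ∈ J} (1 - 𝕃⁻¹ T_j)`. -/
noncomputable def denomPoly (J : Finset (Fin d)) : MvPolynomial (Fin d) (MotivicRing k) :=
  ∏ j ∈ J, (1 - MvPolynomial.C (motLinv k) * MvPolynomial.X j)

variable (k) in
/-- The polynomial `a 𝕃^{-‖n‖} T^n`. -/
noncomputable def termPoly (a : MotivicRing k) (n : Fin d → ℕ) :
    MvPolynomial (Fin d) (MotivicRing k) :=
  MvPolynomial.monomial (Finsupp.equivFunOnFinite.symm n) (a * motLinv k ^ (∑ i, n i))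

theorem coe_denomPoly (J : Finset (Fin d)) :
    (denomPoly k J : MvPowerSeries (Fin d) (MotivicRing k)) = denom k J := by
  rw [← MvPolynomial.coeToMvPowerSeries.ringHom_apply, denomPoly, denom, map_prod]
  simp only [map_sub, map_one, map_mul, MvPolynomial.coeToMvPowerSeries.ringHom_apply,
    MvPolynomial.coe_C, MvPolynomial.coe_X]

theorem coe_termPoly (a : MotivicRing k) (n : Fin d → ℕ) :
    (termPoly k a n : MvPowerSeries (Fin d) (MotivicRing k)) = term k a n :=
  MvPolynomial.coe_monomial _ _

theorem totalDegree_denomPoly_le (J : Finset (Fin d)) : (denomPoly k J).totalDegree ≤ J.card := by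
  refine (MvPolynomial.totalDegree_finsetProd _ _).trans ?_
  rw [Finset.card_eq_sum_ones]
  refine Finset.sum_le_sum fun j _ => (MvPolynomial.totalDegree_sub _ _).trans ?_
  refine max_le (by simp) ?_
  rw [MvPolynomial.C_mul_X_eq_monomial]
  exact (MvPolynomial.totalDegree_monomial_le _ _).trans (by simp)

theorem totalDegree_termPoly_mul_denomPoly_le (a : MotivicRing k) (n : Fin d → ℕ)
    (J : Finset (Fin d)) :
    (termPoly k a n * denomPoly k J).totalDegree ≤ ∑ i, n i + J.card := by
  refine (MvPolynomial.totalDegree_mul _ _).trans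
    (add_le_add ?_ (totalDegree_denomPoly_le J))
  refine (MvPolynomial.totalDegree_monomial_le _ _).trans (le_of_eq ?_)
  exact Finsupp.sum_fintype _ _ fun _ => rfl

/-- At `T_i = 𝕃` the monomial becomes `𝕃^{‖n‖}` and cancels the weight `𝕃^{-‖n‖}`. -/
theorem eval_termPoly (a : MotivicRing k) (n : Fin d → ℕ) :
    MvPolynomial.eval (fun _ => motL k) (termPoly k a n) = a := by
  rw [termPoly, MvPolynomial.eval_monomial, Finsupp.prod_fintype _ _ fun _ => pow_zero _]
  rw [Finset.prod_pow_eq_pow_sum, mul_assoc]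
  change a * (_ * motL k ^ (∑ i, n i)) = a
  rw [← mul_pow, mul_comm (motLinv k), motL_mul_motLinv, one_pow, mul_one]

theorem eval_denomPoly {J : Finset (Fin d)} (hJ : J.Nonempty) :
    MvPolynomial.eval (fun _ => motL k) (denomPoly k J) = 0 := by
  obtain ⟨j, hj⟩ := hJ
  rw [denomPoly, map_prod]
  refine Finset.prod_eq_zero hj ?_
  simp [mul_comm (motLinv k), motL_mul_motLinv]

end PowerSeries

/-! ### The zeta function as a rational function -/

section Zeta

variable {k : Type u} [Field k] {d : ℕ} {O : Subalgebra k (Fin d → PowerSeries k)}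
  {c : Fin d → ℕ}

theorem mem_BSet_iff {J : Finset (Fin d)} {m : {i // i ∉ J} → ℕ} :
    m ∈ BSet O c J ↔ (∀ j : {i // i ∉ J}, m j < c j) ∧ (HSet O c J m).Nonempty := by
  simp [BSet]

/-- This ties the orthants to truncation: the corner `f_J(m)` is the common truncation of all points
of the orthant, so results on `n ⊓ c` transfer to it. -/
theorem fVec_eq_inf {J : Finset (Fin d)} {m : {i // i ∉ J} → ℕ}
    (hm : ∀ j : {i // i ∉ J}, m j < c j) {n : Fin d → ℕ} (hJ : ∀ j ∈ J, c j ≤ n j)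
    (hnm : ∀ j : {i // i ∉ J}, n j = m j) : fVec c J m = n ⊓ c := by
  funext i
  rw [fVec, Pi.inf_apply]
  by_cases h : i ∈ J
  · rw [dif_pos h, inf_eq_right.2 (hJ i h)]
  · rw [dif_neg h, ← hnm ⟨i, h⟩, inf_eq_left.2 (hnm ⟨i, h⟩ ▸ (hm ⟨i, h⟩).le)]

theorem fVec_mem_semigroup (hO : IsCurveSingularityRing O) (hc : IsConductor O c)
    {J : Finset (Fin d)} {m : {i // i ∉ J} → ℕ} (hm : m ∈ BSet O c J) :
    fVec c J m ∈ semigroup O := by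
  obtain ⟨hlt, n, hn, hJ, hnm⟩ := mem_BSet_iff.1 hm
  rw [fVec_eq_inf hlt hJ hnm]
  exact (inf_mem_semigroup_iff hO hc n).2 hn

/-- The orthant of `(J, m)` contains exactly those `n` that are large at `J` and `m` elsewhere. -/
theorem mem_orthant_fVec_iff {J : Finset (Fin d)} {m : {i // i ∉ J} → ℕ} {n : Fin d → ℕ} :
    ((∀ i ∉ J, n i = fVec c J m i) ∧ fVec c J m ≤ n) ↔
      (∀ j ∈ J, c j ≤ n j) ∧ ∀ j : {i // i ∉ J}, n j = m j := by
  constructor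
  · rintro ⟨h1, h2⟩
    refine ⟨fun j hj => ?_, fun j => ?_⟩
    · simpa [fVec, hj] using h2 j
    · simpa [fVec, j.2] using h1 j j.2
  · rintro ⟨h1, h2⟩
    refine ⟨fun i hi => ?_, fun i => ?_⟩
    · simpa [fVec, hi] using h2 ⟨i, hi⟩
    · by_cases hi : i ∈ J
      · simpa [fVec, hi] using h1 i hi
      · simpa [fVec, hi] using (h2 ⟨i, hi⟩).ge

/-- Every point of the orthant truncates to its corner. Hence all of them lie in `S` with the corner
and share its class. -/
theorem coeff_orthant_fVec (hO : IsCurveSingularityRing O) (hc : IsConductor O c)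
    {J : Finset (Fin d)} {m : {i // i ∉ J} → ℕ} (hm : m ∈ BSet O c J) (n : Fin d →₀ ℕ)
    [Decidable ((∀ j ∈ J, c j ≤ n j) ∧ ∀ j : {i // i ∉ J}, n j = m j)] :
    MvPowerSeries.coeff n (orthant k J (fVec c J m)
      (motivicClass k (IVariety hO (fVec c J m)))) =
      if (∀ j ∈ J, c j ≤ n j) ∧ ∀ j : {i // i ∉ J}, n j = m j then
        MvPowerSeries.coeff n (zeta hO) else 0 := by
  classical
  change ite _ _ _ = ite _ (ite _ _ _) _
  refine (if_congr mem_orthant_fVec_iff rfl rfl).trans ?_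
  split_ifs with h hn
  · rw [fVec_eq_inf (mem_BSet_iff.1 hm).1 h.1 h.2, motivicClass_IVariety_inf hO hc]
  · refine absurd ?_ hn
    rw [← inf_mem_semigroup_iff hO hc, ← fVec_eq_inf (mem_BSet_iff.1 hm).1 h.1 h.2]
    exact fVec_mem_semigroup hO hc hm
  · rfl

/-- For fixed `J`, only the restriction of `n` to the complement of `J` can serve as `m`. As `m < c`
there while the entries in `J` are at least `c`, the set `J` is forced by `n`. -/
theorem coeff_sum_orthant (hO : IsCurveSingularityRing O) (hc : IsConductor O c)
    (J : Finset (Fin d)) (n : Fin d →₀ ℕ) :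
    MvPowerSeries.coeff n (∑ m ∈ BSet O c J, orthant k J (fVec c J m)
      (motivicClass k (IVariety hO (fVec c J m)))) =
      if J = Finset.univ.filter (fun i => c i ≤ n i) then
        MvPowerSeries.coeff n (zeta hO) else 0 := by
  classical
  rw [map_sum, Finset.sum_congr rfl fun m hm => coeff_orthant_fVec hO hc hm n]
  split_ifs with hJ
  · have hJ' : ∀ i, i ∈ J ↔ c i ≤ n i := fun i => by simp [hJ]
    by_cases hn : ⇑n ∈ semigroup O
    · rw [Finset.sum_eq_single fun j : {i // i ∉ J} => n j]
      · exact if_pos ⟨fun j hj => (hJ' j).1 hj, fun _ => rfl⟩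
      · intro m _ hne
        exact if_neg fun h => hne (funext fun j => (h.2 j).symm)
      · intro h
        refine absurd (mem_BSet_iff.2 ⟨fun j => ?_, n, hn, fun j hj => (hJ' j).1 hj,
          fun _ => rfl⟩) h
        exact not_le.1 fun hle => j.2 ((hJ' j).2 hle)
    -- Outside `S` the coefficient of the zeta function is zero, so both sides vanish.
    · have h0 : MvPowerSeries.coeff n (zeta hO) = 0 := if_neg hn
      simp [h0]
  · refine Finset.sum_eq_zero fun m hm => if_neg fun h => hJ ?_
    ext i
    simp only [Finset.mem_filter_univ]
    refine ⟨h.1 i, fun hle => ?_⟩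
    by_contra hi
    have h1 := (mem_BSet_iff.1 hm).1 ⟨i, hi⟩
    rw [← h.2 ⟨i, hi⟩] at h1
    exact absurd hle (not_le.2 h1)

/-- This is the case `J = ∅`, put into the shape of `coeff_sum_orthant` so that all contributions
can be compared in `zeta_eq`. -/
theorem coeff_sum_small (hO : IsCurveSingularityRing O) (n : Fin d →₀ ℕ) :
    MvPowerSeries.coeff n (∑ m ∈ smallValues O c, term k (motivicClass k (IVariety hO m)) m) =
      if ∅ = Finset.univ.filter (fun i => c i ≤ n i) then
        MvPowerSeries.coeff n (zeta hO) else 0 := by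
  classical
  have hsmall : ∀ m, m ∈ smallValues O c ↔ (∀ i, m i < c i) ∧ m ∈ semigroup O := fun m => by
    simp [smallValues]
  have hempty : ∅ = Finset.univ.filter (fun i => c i ≤ n i) ↔ ∀ i, n i < c i := by
    rw [eq_comm, Finset.filter_eq_empty_iff]
    simp
  have hterm : ∀ m ∈ smallValues O c,
      MvPowerSeries.coeff n (term k (motivicClass k (IVariety hO m)) m) =
        if ⇑n = m then MvPowerSeries.coeff n (zeta hO) else 0 := by
    intro m hm
    rw [term, MvPowerSeries.coeff_monomial]
    by_cases h : ⇑n = m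
    · subst h
      have hn : n = Finsupp.equivFunOnFinite.symm ⇑n := DFunLike.coe_injective rfl
      rw [if_pos rfl, if_pos hn]
      exact (if_pos ((hsmall _).1 hm).2).symm
    · rw [if_neg h, if_neg fun h' => h (by rw [h']; rfl)]
  rw [map_sum, Finset.sum_congr rfl hterm, Finset.sum_ite_eq]
  by_cases hn : ⇑n ∈ semigroup O
  · exact if_congr (((hsmall _).trans (and_iff_left hn)).trans hempty.symm) rfl rfl
  · have h0 : MvPowerSeries.coeff n (zeta hO) = 0 := if_neg hn
    simp [h0]

/-- This is the case `J = univ`, a single orthant with corner `c`, where the class is `[ℐ_c] = [𝒥]`.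
-/
theorem coeff_orthant_univ (hO : IsCurveSingularityRing O) (hc : IsConductor O c)
    (n : Fin d →₀ ℕ) :
    MvPowerSeries.coeff n (orthant k Finset.univ c (motivicClass k (JVariety hO))) =
      if Finset.univ = Finset.univ.filter (fun i => c i ≤ n i) then
        MvPowerSeries.coeff n (zeta hO) else 0 := by
  classical
  have huniv : Finset.univ = Finset.univ.filter (fun i => c i ≤ n i) ↔ c ≤ ⇑n := by
    rw [eq_comm, Finset.filter_eq_self]
    simp [Pi.le_def]
  change ite _ _ _ = ite _ (ite _ _ _) _
  by_cases h : c ≤ ⇑n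
  · rw [if_pos ⟨fun i hi => absurd (Finset.mem_univ i) hi, h⟩, if_pos (huniv.2 h),
      if_pos (hc.mem_of_le h), ← motivicClass_IVariety_conductor hO hc,
      ← motivicClass_IVariety_inf hO hc n, inf_eq_right.2 h]
  · rw [if_neg fun h' => h h'.2, if_neg (mt huniv.1 h)]

/-- Compare coefficients: for each exponent `n`, only the contribution indexed by `J = {i | c i ≤ n
i}` is present, and it equals the coefficient of the zeta function. -/
theorem zeta_eq (hO : IsCurveSingularityRing O) (hc : IsConductor O c) :
    zeta hO =
      ∑ n ∈ smallValues O c, term k (motivicClass k (IVariety hO n)) n +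
      ∑ J : Finset (Fin d) with J.Nonempty ∧ J ≠ Finset.univ, ∑ m ∈ BSet O c J,
        term k (motivicClass k (IVariety hO (fVec c J m))) (fVec c J m) * invDenom k J +
      term k (motivicClass k (JVariety hO)) c * invDenom k Finset.univ := by
  classical
  simp only [term_mul_invDenom]
  ext n
  rw [map_add, map_add, coeff_sum_small, coeff_orthant_univ hO hc, map_sum,
    Finset.sum_congr rfl fun J _ => coeff_sum_orthant hO hc J n, Finset.sum_ite_eq']
  simp only [Finset.mem_filter_univ]
  generalize Finset.univ.filter (fun i => c i ≤ n i) = J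
  have hd : (∅ : Finset (Fin d)) ≠ Finset.univ := by
    have : Nonempty (Fin d) := ⟨⟨0, hO.dim_pos⟩⟩
    exact Finset.univ_nonempty.ne_empty.symm
  by_cases h1 : ∅ = J
  · subst h1
    simp [hd.symm]
  · by_cases h2 : Finset.univ = J
    · subst h2
      simp [hd]
    · have h3 : J.Nonempty ∧ J ≠ Finset.univ :=
        ⟨Finset.nonempty_iff_ne_empty.2 (Ne.symm h1), Ne.symm h2⟩
      rw [if_neg h1, if_neg h2, if_pos h3, zero_add, add_zero]

/-! ### The common numerator -/

/-- The numerator of the zeta function. -/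
noncomputable def numerator (hO : IsCurveSingularityRing O) (c : Fin d → ℕ) :
    MvPolynomial (Fin d) (MotivicRing k) :=
  ∑ n ∈ smallValues O c, termPoly k (motivicClass k (IVariety hO n)) n * denomPoly k Finset.univ +
  ∑ J : Finset (Fin d) with J.Nonempty ∧ J ≠ Finset.univ, ∑ m ∈ BSet O c J,
    termPoly k (motivicClass k (IVariety hO (fVec c J m))) (fVec c J m) * denomPoly k Jᶜ +
  termPoly k (motivicClass k (JVariety hO)) c

/-- The bound holds branch by branch. A branch in `J` contributes `c i`; a branch outside
contributes its entry and one denominator factor, at most `c i` together because the entry is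
strictly below `c i`. -/
theorem totalDegree_numerator_le (hO : IsCurveSingularityRing O) (c : Fin d → ℕ) :
    (numerator hO c).totalDegree ≤ ∑ i, c i := by
  classical
  refine (MvPolynomial.totalDegree_add _ _).trans (max_le
    ((MvPolynomial.totalDegree_add _ _).trans (max_le ?_ ?_)) ?_)
  · refine MvPolynomial.totalDegree_finsetSum_le fun n hn => ?_
    refine (totalDegree_termPoly_mul_denomPoly_le _ _ _).trans ?_
    rw [Finset.card_eq_sum_ones, ← Finset.sum_add_distrib]
    refine Finset.sum_le_sum fun i _ => ?_
    have h : ∀ i, n i < c i := by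
      simp only [smallValues, Finset.mem_filter, Fintype.mem_piFinset, Finset.mem_range] at hn
      exact hn.1
    exact h i
  · refine MvPolynomial.totalDegree_finsetSum_le fun J _ =>
      MvPolynomial.totalDegree_finsetSum_le fun m hm => ?_
    refine (totalDegree_termPoly_mul_denomPoly_le _ _ _).trans ?_
    have hcard : Jᶜ.card = ∑ i, if i ∈ J then 0 else 1 := by
      rw [Finset.card_eq_sum_ones, Finset.sum_ite, Finset.sum_const_zero, zero_add]
      exact Finset.sum_congr (by ext; simp) fun _ _ => rfl
    rw [hcard, ← Finset.sum_add_distrib]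
    refine Finset.sum_le_sum fun i _ => ?_
    by_cases hi : i ∈ J
    · simp [fVec, hi]
    · simpa [fVec, hi] using (mem_BSet_iff.1 hm).1 ⟨i, hi⟩
  -- The last term is multiplied by the empty product, so the general bound applies with `J = ∅`.
  · simpa [denomPoly] using totalDegree_termPoly_mul_denomPoly_le
      (motivicClass k (JVariety hO)) c ∅

/-- Every term but the last carries a vanishing factor: over `univ`, nonempty because `0 < d`, or
over `Jᶜ`, nonempty because `J ≠ univ`. -/
theorem eval_numerator (hO : IsCurveSingularityRing O) (c : Fin d → ℕ) :
    MvPolynomial.eval (fun _ => motL k) (numerator hO c) = motivicClass k (JVariety hO) := by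
  have : Nonempty (Fin d) := ⟨⟨0, hO.dim_pos⟩⟩
  rw [numerator, map_add, map_add, eval_termPoly, map_sum, map_sum, Finset.sum_eq_zero,
    Finset.sum_eq_zero, zero_add, zero_add]
  · intro J hJ
    rw [map_sum]
    refine Finset.sum_eq_zero fun m _ => ?_
    rw [map_mul, eval_denomPoly, mul_zero]
    rw [Finset.nonempty_iff_ne_empty, Ne, Finset.compl_eq_empty_iff]
    exact (Finset.mem_filter.1 hJ).2.2
  · intro n _
    rw [map_mul, eval_denomPoly Finset.univ_nonempty, mul_zero]

theorem zeta_eq_numerator_mul (hO : IsCurveSingularityRing O) (hc : IsConductor O c) :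
    zeta hO = (numerator hO c : MvPowerSeries (Fin d) (MotivicRing k)) *
      invDenom k Finset.univ := by
  have hcoe : (numerator hO c : MvPowerSeries (Fin d) (MotivicRing k)) =
      ∑ n ∈ smallValues O c, term k (motivicClass k (IVariety hO n)) n * denom k Finset.univ +
      ∑ J : Finset (Fin d) with J.Nonempty ∧ J ≠ Finset.univ, ∑ m ∈ BSet O c J,
        term k (motivicClass k (IVariety hO (fVec c J m))) (fVec c J m) * denom k Jᶜ +
      term k (motivicClass k (JVariety hO)) c := by
    simp only [← coe_termPoly, ← coe_denomPoly, ← MvPolynomial.coeToMvPowerSeries.ringHom_apply,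
      ← map_mul, ← map_sum, ← map_add]
    rfl
  rw [zeta_eq hO hc, hcoe, add_mul, add_mul]
  congr 2
  · rw [Finset.sum_mul]
    refine Finset.sum_congr rfl fun n _ => ?_
    rw [mul_assoc, denom_mul_invDenom, mul_one]
  · rw [Finset.sum_mul]
    refine Finset.sum_congr rfl fun J _ => ?_
    rw [Finset.sum_mul]
    refine Finset.sum_congr rfl fun m _ => ?_
    rw [invDenom_eq J, mul_assoc]

end Zeta

end MotivicZeta

theorem theorem6 {k : Type*} [Field k] {d : ℕ} (O : Subalgebra k (Fin d → PowerSeries k))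
    (hO : IsCurveSingularityRing O) (c : Fin d → ℕ)
    (hc : IsConductor O c) :
    ((∀ J : Finset (Fin d), ∀ m ∈ BSet O c J,
        fVec c J m ∈ semigroup O) ∧
      zeta hO =
        ∑ n ∈ smallValues O c,
          term k
            (motivicClass k (IVariety hO n)) n +
        ∑ J : Finset (Fin d) with J.Nonempty ∧ J ≠ Finset.univ,
          ∑ m ∈ BSet O c J,
            term k
              (motivicClass k (IVariety hO (fVec c J m)))
              (fVec c J m) * invDenom k J +
        term k (motivicClass k (JVariety hO)) c *
          invDenom k Finset.univ) ∧
    ∃ M : MvPolynomial (Fin d) (MotivicRing k),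
      M.totalDegree ≤ ∑ i, c i ∧
      MvPolynomial.eval (fun _ => motL k) M =
        motivicClass k (JVariety hO) ∧
      zeta hO =
        (M : MvPowerSeries (Fin d) (MotivicRing k)) *
          invDenom k Finset.univ := by
  exact ⟨⟨fun _ _ hm => fVec_mem_semigroup hO hc hm, zeta_eq hO hc⟩, numerator hO c,
    totalDegree_numerator_le hO c, eval_numerator hO c, zeta_eq_numerator_mul hO hc⟩
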